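/- **Theorem (quantum ergodicity at logarithmic scales in phase space).** *Quantum cat maps.* Let $M=\begin{pmatrix}A&B\\ C&D_0\end{pmatrix}\in\mathrm{SL}(2,\mathbb Z)$ with $|\mathrm{Tr}\,M|>2$, and $h=1/N$, $N\in\mathbb N$, $N\ge1$. Let $\hat M$ be its quantization on tempered distributions on $\mathbb R$, i.e. the operator with kernel $(ihB)^{-1/2}\exp\!\big(\tfrac{\pi i}{hB}(D_0q^2-2qq'+Aq'^2)\big)$; if $\mathrm{Tr}\,M>2$ this is the propagator $e^{-2\pi i\hat H/h}$ of the quadratic Hamiltonian whose classical flow at time $1$ is $M$. Let $\hat T_v f(q)=e^{\frac{2\pi i}{h}v_2(q-v_1/2)}f(q-v_1)$ and $\hat T_N(n)=\hat T_{n/N}$ for $n\in\mathbb Z^2$. For $\kappa\in\mathbb R^2$ let $\mathcal H_{N,\kappa}$ be the $N$-dimensional space of distributions $\psi=\sum_{k\in\mathbb Z}\Psi(k)\,\delta(q-(k+\kappa_1)/N)$ with $\Psi(k+N)=e^{-2\pi i\kappa_2}\Psi(k)$ and $\langle\psi,\phi\rangle=\frac1N\sum_{k=1}^N\Psi(k)\overline{\Phi(k)}$.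 For each $N$ fix any $\kappa=\kappa(N)$ such that $\hat M\mathcal H_{N,\kappa}\subseteq\mathcal H_{N,\kappa}$ and write $\mathcal H_N=\mathcal H_{N,\kappa(N)}$. An eigenbasis is an orthonormal basis $\{\phi_j\}_{j=1}^N$ of $\mathcal H_N$ with $\hat M\phi_j=e^{i\theta_j}\phi_j$, $\theta_j\in\mathbb R$. For a trigonometric polynomial $a(x)=\sum_{n}\tilde a(n)e^{2\pi i(n_2x_1-n_1x_2)}$ on $\mathbb T^2=\mathbb R^2/\mathbb Z^2$ put $\mathrm{Op}_N(a)=\sum_n\tilde a(n)\hat T_N(n)$. *Majorants and minorants.* Let $0\le\alpha<1/4$, $r=r(N)=(\log N)^{-\alpha}$, and let $D=D(N)$ satisfy $1/D=o(r)$, $D>0$ for large $N$, and $D^4=o(\log N)$ as $N\to\infty$ (for instance $D=(\log N)^\beta$ with $\alpha<\beta<1/4$). Let $B_2(x,r)\subset\mathbb T^2$ be the open geodesic ball. Call real-valued trigonometric polynomials $a_N^\pm$ on $\mathbb T^2$ *admissible* if for some constant $c$ and all large $N$: $a_N^-\le\chi_{B_2(0,r)}\le a_N^+$; $\widetilde{a_N^\pm}(n)=0$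 for $|n|\ge D$; $|\widetilde{a_N^\pm}(n)|\le cr^2$ for all $n$; and if $\widetilde{a_N^\pm}(0)=\mathrm{Vol}(B_2(0,r))+o(r^2)$ as $N\to\infty$. Put $b^\pm_{x,r}=a_N^\pm(\cdot-x)$. *Conclusion.* Admissible $a_N^\pm$ exist. For every choice of admissible $a_N^\pm$, quantum ergodicity at scale $r=(\log N)^{-\alpha}$ holds for $N\in\mathbb N$: for every choice, for each $N$, of an eigenbasis $\{\phi_j\}_{j=1}^N$ of $\hat M$ in $\mathcal H_N$ there are subsets $S(N)\subseteq\{1,\dots,N\}$ with $\#S(N)/N\to1$ such that $$\langle\mathrm{Op}_N(b^\pm_{x,r})\phi_j,\phi_j\rangle=\mathrm{Vol}(B_2(x,r))+o(r^2)\qquad(N\to\infty),$$ for both signs, uniformly in $j\in S(N)$ and $x\in\mathbb T^2$. -/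

import Mathlib

open Filter Topology MeasureTheory Asymptotics
open scoped SchwartzMap FourierTransform MatrixGroups

noncomputable section

namespace QuantumCat

/-! ### Quantum mechanics on the line

`h > 0` is the Planck constant. Operators are given on Schwartz functions and are extended to
tempered distributions by transposition with respect to the bilinear pairing `∫ u f`. -/

theorem hasTemperateGrowth_expI :
    Function.HasTemperateGrowth (fun x : ℝ => Complex.exp (Complex.I * (x : ℂ))) := by
  have hc : ∀ m : WithTop ℕ∞,
      ContDiff ℝ m (fun x : ℝ => Complex.exp (Complex.I * (x : ℂ))) := fun m =>
    (contDiff_const.mul Complex.ofRealCLM.contDiff).cexp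
  have hd : ∀ n : ℕ, iteratedDeriv n (fun x : ℝ => Complex.exp (Complex.I * (x : ℂ))) =
      fun x : ℝ => Complex.I ^ n * Complex.exp (Complex.I * (x : ℂ)) := by
    intro n
    induction n with
    | zero => simp
    | succ n ih =>
      rw [iteratedDeriv_succ, ih]
      funext x
      have h1 : HasDerivAt (fun x : ℝ => Complex.I * (x : ℂ)) Complex.I x := by
        simpa using (Complex.ofRealCLM.hasDerivAt (x := x)).const_mul Complex.I
      rw [(h1.cexp.const_mul (Complex.I ^ n)).deriv]
      ring
  refine ⟨hc _, fun n => ⟨0, 1, fun x => ?_⟩⟩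
  rw [norm_iteratedFDeriv_eq_norm_iteratedDeriv, hd]
  simp [Complex.norm_exp]

theorem hasTemperateGrowth_expI_comp {g : ℝ → ℝ} (hg : g.HasTemperateGrowth) :
    Function.HasTemperateGrowth (fun x : ℝ => Complex.exp (Complex.I * (g x : ℂ))) :=
  hasTemperateGrowth_expI.comp hg

/-- Multiplication of a Schwartz function by the unimodular function `q ↦ e^{i g(q)}`. -/
def mulPhase (g : ℝ → ℝ) : 𝓢(ℝ, ℂ) →L[ℂ] 𝓢(ℝ, ℂ) :=
  SchwartzMap.smulLeftCLM ℂ (fun q : ℝ => Complex.exp (Complex.I * (g q : ℂ)))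

theorem mulPhase_apply {g : ℝ → ℝ} (hg : g.HasTemperateGrowth) (f : 𝓢(ℝ, ℂ)) (q : ℝ) :
    mulPhase g f q = Complex.exp (Complex.I * (g q : ℂ)) * f q := by
  simp [mulPhase, SchwartzMap.smulLeftCLM_apply_apply (hasTemperateGrowth_expI_comp hg)]

/-- The dilation `f ↦ f (s ·)`, for `s ≠ 0` (and `0` for `s = 0`). -/
def dilation (s : ℝ) : 𝓢(ℝ, ℂ) →L[ℂ] 𝓢(ℝ, ℂ) :=
  if hs : s ≠ 0 then
    SchwartzMap.compCLMOfContinuousLinearEquiv ℂ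
      (ContinuousLinearEquiv.unitsEquivAut ℝ (Units.mk0 s hs))
  else 0

theorem dilation_apply {s : ℝ} (hs : s ≠ 0) (f : 𝓢(ℝ, ℂ)) (q : ℝ) :
    dilation s f q = f (s * q) := by
  simp [dilation, hs, mul_comm]

/-- The phase space translation `T̂_v = exp(-(2πi/h)(v₁ p̂ - v₂ q̂))`, that is
`(T̂_v f)(q) = e^{(2πi/h) v₂ (q - v₁/2)} f(q - v₁)`. -/
def translation (h : ℝ) (v : ℝ × ℝ) : 𝓢(ℝ, ℂ) →L[ℂ] 𝓢(ℝ, ℂ) :=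
  mulPhase (fun q => 2 * Real.pi / h * v.2 * (q - v.1 / 2)) ∘L SchwartzMap.compSubConstCLM ℂ v.1

theorem translation_apply (h : ℝ) (v : ℝ × ℝ) (f : 𝓢(ℝ, ℂ)) (q : ℝ) :
    translation h v f q =
      Complex.exp (Complex.I * ((2 * Real.pi / h * v.2 * (q - v.1 / 2) : ℝ) : ℂ)) * f (q - v.1) := by
  rw [translation, ContinuousLinearMap.comp_apply, mulPhase_apply (by fun_prop)]
  rfl

/-- `T̂_v` on tempered distributions; the transpose of `T̂_{(v₁, v₂)}` is `T̂_{(-v₁, v₂)}`. -/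
def translationDist (h : ℝ) (v : ℝ × ℝ) : 𝓢'(ℝ, ℂ) →L[ℂ] 𝓢'(ℝ, ℂ) :=
  PointwiseConvergenceCLM.precomp ℂ (translation h (-v.1, v.2))

/-- For a quadratic Hamiltonian `H = ½ α q² + ½ β p² + γ q p` whose flow at time one is the linear
map `(q, p) ↦ (A q + B p, C q + D p)` of determinant one with `B ≠ 0`, this is the integral kernel
of the propagator `e^{-2πi Ĥ/h}`:
`(i h B)^{-1/2} exp((πi/(hB)) (D q² - 2 q q' + A q'²))`. -/
def kernel (h A B D q q' : ℝ) : ℂ :=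
  (1 / (Complex.I * h * B)) ^ (1 / 2 : ℂ) *
    Complex.exp (Complex.I * ((Real.pi / (h * B) * (D * q ^ 2 - 2 * q * q' + A * q' ^ 2) : ℝ) : ℂ))

/-- The operator with integral kernel `kernel h A B D` on Schwartz functions
(see `metaplectic_apply`). -/
def metaplectic (h A B D : ℝ) : 𝓢(ℝ, ℂ) →L[ℂ] 𝓢(ℝ, ℂ) :=
  ((1 / (Complex.I * h * B)) ^ (1 / 2 : ℂ)) •
    (mulPhase (fun q => Real.pi / (h * B) * D * q ^ 2) ∘L dilation (1 / (h * B)) ∘L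
      FourierTransform.fourierCLM ℂ 𝓢(ℝ, ℂ) ∘L mulPhase (fun q => Real.pi / (h * B) * A * q ^ 2))

theorem metaplectic_apply {h B : ℝ} (hh : h ≠ 0) (hB : B ≠ 0) (A D : ℝ) (f : 𝓢(ℝ, ℂ)) (q : ℝ) :
    metaplectic h A B D f q = ∫ q' : ℝ, kernel h A B D q q' * f q' := by
  have hs : 1 / (h * B) ≠ 0 := by positivity
  simp only [metaplectic, smul_apply, ContinuousLinearMap.comp_apply]
  rw [mulPhase_apply (by fun_prop), dilation_apply hs, FourierTransform.fourierCLM_apply,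
    SchwartzMap.fourier_coe, Real.fourier_real_eq_integral_exp_smul, ← integral_const_mul,
    smul_eq_mul, ← integral_const_mul]
  refine integral_congr_ae (Eventually.of_forall fun q' => ?_)
  simp only [smul_eq_mul]
  rw [mulPhase_apply (by fun_prop), kernel]
  have e : Complex.exp (Complex.I *
      ((Real.pi / (h * B) * (D * q ^ 2 - 2 * q * q' + A * q' ^ 2) : ℝ) : ℂ)) =
      Complex.exp (Complex.I * ((Real.pi / (h * B) * D * q ^ 2 : ℝ) : ℂ)) *
      (Complex.exp (((-2 * Real.pi * q' * (1 / (h * B) * q) : ℝ) : ℂ) * Complex.I) *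
      Complex.exp (Complex.I * ((Real.pi / (h * B) * A * q' ^ 2 : ℝ) : ℂ))) := by
    rw [← Complex.exp_add, ← Complex.exp_add]
    congr 1
    push_cast
    ring
  rw [e]
  ring

/-- The Weyl quantization `Ĥ = ½ α q̂² + ½ β p̂² + ½ γ (q̂ p̂ + p̂ q̂)` of
`H = ½ α q² + ½ β p² + γ q p`, where `q̂` is multiplication by `q` and `p̂ = (h/(2πi)) d/dq`. -/
def hamiltonian (h α β γ : ℝ) (u : ℝ → ℂ) : ℝ → ℂ :=
  let Q : (ℝ → ℂ) → ℝ → ℂ := fun w q => (q : ℂ) * w q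
  let P : (ℝ → ℂ) → ℝ → ℂ := fun w q => (h : ℂ) / (2 * Real.pi * Complex.I) * deriv w q
  fun q => 1 / 2 * α * Q (Q u) q + 1 / 2 * β * P (P u) q + γ / 2 * (Q (P u) q + P (Q u) q)

/-- Along the Hamiltonian flow `M(t) = (A B; C D)`, `M' = (γ β; -α -γ) M`, the kernel solves the
Schrödinger equation `(ih/2π) ∂ₜ K = Ĥ K`. -/
theorem kernel_schrodinger {h α β γ : ℝ} (hh : 0 < h) {A B C D : ℝ → ℝ}
    (hA : ∀ t, HasDerivAt A (γ * A t + β * C t) t) (hB : ∀ t, HasDerivAt B (γ * B t + β * D t) t)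
    (hD : ∀ t, HasDerivAt D (-α * B t - γ * D t) t) (hdet : ∀ t, A t * D t - B t * C t = 1)
    {t : ℝ} (ht : B t ≠ 0) (q q' : ℝ) :
    Complex.I * h / (2 * Real.pi) * deriv (fun s => kernel h (A s) (B s) (D s) q q') t =
      hamiltonian h α β γ (fun x => kernel h (A t) (B t) (D t) x q') q := by
  have hπ : (Real.pi : ℂ) ≠ 0 := by exact_mod_cast Real.pi_ne_zero
  have hhC : (h : ℂ) ≠ 0 := by exact_mod_cast hh.ne'
  have hBC : (B t : ℂ) ≠ 0 := by exact_mod_cast ht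
  have hI := Complex.I_ne_zero
  have hI2 := Complex.I_sq
  set c : ℝ → ℂ := fun s => 1 / (Complex.I * h * B s) with hc
  have hcne : c t ≠ 0 := by simp [hc, hhC, hBC]
  have hslit : c t ∈ Complex.slitPlane := by
    refine Or.inr ?_
    have : c t = ((-(1 / (h * B t)) : ℝ) : ℂ) * Complex.I := by
      simp only [hc]
      push_cast
      field_simp
      rw [hI2]
      norm_num
    rw [this, Complex.im_ofReal_mul, Complex.I_im, mul_one]
    have : h * B t ≠ 0 := mul_ne_zero hh.ne' ht
    exact neg_ne_zero.2 (one_div_ne_zero this)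
  have hBd : HasDerivAt (fun s => (B s : ℂ)) ((γ * B t + β * D t : ℝ) : ℂ) t := (hB t).ofReal_comp
  have hcd : HasDerivAt c (-c t * ((γ * B t + β * D t : ℝ) : ℂ) / B t) t := by
    have h1 := ((hBd.const_mul (Complex.I * h)).inv (by simp [hhC, hBC]))
    have h2 : c = (fun s => Complex.I * h * (B s : ℂ))⁻¹ := by
      funext s
      simp [hc]
    rw [h2]
    refine h1.congr_deriv ?_
    simp only [Pi.inv_apply]
    field_simp
  have hw : HasDerivAt (fun s => c s ^ (1 / 2 : ℂ))
      (-(1 / 2) * c t ^ (1 / 2 : ℂ) * ((γ * B t + β * D t : ℝ) : ℂ) / B t) t := by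
    have h1 := (Complex.hasStrictDerivAt_cpow_const (c := (1 / 2 : ℂ)) hslit).hasDerivAt.comp t hcd
    refine h1.congr_deriv ?_
    rw [Complex.cpow_sub _ _ hcne, Complex.cpow_one]
    field_simp
  have hEt : HasDerivAt
      (fun s => Real.pi / (h * B s) * (D s * q ^ 2 - 2 * q * q' + A s * q' ^ 2))
      (-(Real.pi * (γ * B t + β * D t) / (h * B t ^ 2)) *
          (D t * q ^ 2 - 2 * q * q' + A t * q' ^ 2) +
        Real.pi / (h * B t) *
          ((-α * B t - γ * D t) * q ^ 2 + (γ * A t + β * C t) * q' ^ 2)) t := by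
    have h1 := ((((hB t).const_mul h).inv (mul_ne_zero hh.ne' ht)).const_mul Real.pi).mul
      ((((hD t).mul_const (q ^ 2)).sub_const (2 * q * q')).add ((hA t).mul_const (q' ^ 2)))
    refine (h1.congr_deriv ?_).congr_of_eventuallyEq (Eventually.of_forall fun s => ?_)
    · simp only [Pi.inv_apply, Pi.add_apply]
      field_simp
    · simp [div_eq_mul_inv]
  have hKt := hw.mul (hEt.ofReal_comp.const_mul Complex.I).cexp
  set K : ℝ → ℂ := fun x => kernel h (A t) (B t) (D t) x q' with hK
  have hKq : ∀ x : ℝ, HasDerivAt K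
      (Complex.I * (2 * Real.pi / (h * B t) * (D t * x - q')) * K x) x := by
    intro x
    have h1 : HasDerivAt
        (fun x : ℝ => Real.pi / (h * B t) * (D t * x ^ 2 - 2 * x * q' + A t * q' ^ 2))
        (2 * Real.pi / (h * B t) * (D t * x - q')) x := by
      have h2 := (((((hasDerivAt_id x).pow 2).const_mul (D t)).sub
        (((hasDerivAt_id x).const_mul 2).mul_const q')).add_const (A t * q' ^ 2)).const_mul
          (Real.pi / (h * B t))
      refine h2.congr_deriv ?_
      simp
      ring
    have h3 := ((h1.ofReal_comp.const_mul Complex.I).cexp).const_mul (c t ^ (1 / 2 : ℂ))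
    refine h3.congr_deriv ?_
    simp only [hK, kernel, hc]
    push_cast
    ring
  have hP : (fun x : ℝ => (h : ℂ) / (2 * Real.pi * Complex.I) * deriv K x) =
      fun x : ℝ => (1 / B t * (D t * x - q') : ℂ) * K x := by
    funext x
    rw [(hKq x).deriv]
    field_simp
  have hPP : deriv (fun x : ℝ => (1 / B t * (D t * x - q') : ℂ) * K x) q =
      (D t / B t : ℂ) * K q + (1 / B t * (D t * q - q') : ℂ) *
        (Complex.I * (2 * Real.pi / (h * B t) * (D t * q - q')) * K q) := by
    have h1 : HasDerivAt (fun x : ℝ => (1 / B t * (D t * x - q') : ℂ)) (D t / B t : ℂ) q := by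
      have h2 := (((Complex.ofRealCLM.hasDerivAt (x := q)).const_mul (D t : ℂ)).sub_const
        (q' : ℂ)).const_mul (1 / B t : ℂ)
      refine h2.congr_deriv ?_
      simp
      ring
    exact (h1.mul (hKq q)).deriv
  have hPQ : deriv (fun x : ℝ => (x : ℂ) * K x) q =
      K q + q * (Complex.I * (2 * Real.pi / (h * B t) * (D t * q - q')) * K q) := by
    have h1 : HasDerivAt (fun x : ℝ => (x : ℂ)) 1 q := Complex.ofRealCLM.hasDerivAt
    exact (h1.mul (hKq q)).deriv.trans (by rw [one_mul])
  have hdetC : (A t : ℂ) * D t - B t * C t = 1 := by exact_mod_cast hdet t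
  have hC : (C t : ℂ) = (A t * D t - 1) / B t := by
    field_simp
    linear_combination -hdetC
  have hKq0 : K q = c t ^ (1 / 2 : ℂ) * Complex.exp (Complex.I *
      ((Real.pi / (h * B t) * (D t * q ^ 2 - 2 * q * q' + A t * q' ^ 2) : ℝ) : ℂ)) := rfl
  have hL := hKt.deriv
  change deriv (fun s => kernel h (A s) (B s) (D s) q q') t = _ at hL
  rw [hL]
  simp only [hamiltonian]
  rw [hP, hPP, hPQ]
  have hPq := congrFun hP q
  rw [hPq]
  rw [hKq0]
  have key : Complex.I * h / (2 * Real.pi) *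
      (-(1 / 2) * ((γ * B t + β * D t : ℝ) : ℂ) / B t + Complex.I *
        ((-(Real.pi * (γ * B t + β * D t) / (h * B t ^ 2)) *
            (D t * q ^ 2 - 2 * q * q' + A t * q' ^ 2) +
          Real.pi / (h * B t) *
            ((-α * B t - γ * D t) * q ^ 2 + (γ * A t + β * C t) * q' ^ 2) : ℝ) : ℂ)) =
      1 / 2 * α * (q * q) + 1 / 2 * β * (h / (2 * Real.pi * Complex.I) *
        (D t / B t + 1 / B t * (D t * q - q') *
          (Complex.I * (2 * Real.pi / (h * B t) * (D t * q - q'))))) +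
      γ / 2 * (q * (1 / B t * (D t * q - q')) + h / (2 * Real.pi * Complex.I) *
        (1 + q * (Complex.I * (2 * Real.pi / (h * B t) * (D t * q - q'))))) := by
    push_cast
    rw [hC]
    field_simp
    ring_nf
    simp only [hI2, show Complex.I ^ 3 = -Complex.I by
      rw [pow_succ, hI2]; ring]
    ring
  linear_combination (c t ^ (1 / 2 : ℂ) * Complex.exp (Complex.I *
      ((Real.pi / (h * B t) * (D t * q ^ 2 - 2 * q * q' + A t * q' ^ 2) : ℝ) : ℂ))) * key

/-- The quantization `M̂` of `M = (A B; C D) ∈ SL(2, ℤ)` with `B ≠ 0` (which holds for every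
hyperbolic `M`), at Planck constant `h`, acting on tempered distributions. The transpose of the
operator with kernel `K(q, q')` has kernel `K(q', q)`, which exchanges `A` and `D`. For trace `> 2` this is
`e^{-2πi Ĥ/h}`; for trace `< -2` it is, up to a phase, that propagator for `-M` followed by the
parity `q ↦ -q`. -/
def quantization (h : ℝ) (M : SL(2, ℤ)) : 𝓢'(ℝ, ℂ) →L[ℂ] 𝓢'(ℝ, ℂ) :=
  PointwiseConvergenceCLM.precomp ℂ (metaplectic h (M 1 1) (M 0 1) (M 0 0))

/-! ### Quantum states on the torus -/

/-- The space `H_{N,κ}`, described by the coefficients `Ψ` of the distributions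
`∑ₖ Ψ(k) δ(q - (k + κ₁)/N)`; these satisfy `Ψ(k + N) = e^{-2πi κ₂} Ψ(k)`. -/
def State (N : ℕ) (κ : ℝ × ℝ) : Submodule ℂ (ℤ → ℂ) where
  carrier := {Ψ | ∀ k : ℤ, Ψ (k + N) = Complex.exp (-2 * Real.pi * Complex.I * κ.2) * Ψ k}
  add_mem' := by
    intro a b ha hb k
    simp only [Pi.add_apply, ha k, hb k]
    ring
  zero_mem' := by
    intro k
    simp
  smul_mem' := by
    intro c a ha k
    simp only [Pi.smul_apply, smul_eq_mul, ha k]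
    ring

theorem exists_bound {N : ℕ} (hN : 0 < N) {κ : ℝ × ℝ} (Ψ : State N κ) :
    ∃ C : ℝ, 0 ≤ C ∧ ∀ k : ℤ, ‖(Ψ : ℤ → ℂ) k‖ ≤ C := by
  have hper : Function.Periodic (fun k : ℤ => ‖(Ψ : ℤ → ℂ) k‖) (N : ℤ) := by
    intro k
    have h1 : ‖Complex.exp (-2 * Real.pi * Complex.I * κ.2)‖ = 1 := by
      simp [Complex.norm_exp]
    simp only [Ψ.2 k, norm_mul, h1, one_mul]
  refine ⟨∑ i ∈ Finset.range N, ‖(Ψ : ℤ → ℂ) i‖,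
    Finset.sum_nonneg fun _ _ => norm_nonneg _, fun k => ?_⟩
  have hN' : (0 : ℤ) < N := by exact_mod_cast hN
  have h0 : 0 ≤ k % (N : ℤ) := Int.emod_nonneg _ hN'.ne'
  have h2 : k % (N : ℤ) < N := Int.emod_lt_of_pos _ hN'
  have h3 : ‖(Ψ : ℤ → ℂ) k‖ = ‖(Ψ : ℤ → ℂ) ((k % (N : ℤ)).toNat : ℤ)‖ := by
    rw [Int.toNat_of_nonneg h0]
    have := hper.int_mul (k / (N : ℤ)) (k % (N : ℤ))
    rw [← this]
    congr 2
    have := Int.emod_add_mul_ediv k N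
    rw [Int.cast_id, mul_comm (k / (N : ℤ)), this]
  rw [h3]
  exact Finset.single_le_sum (f := fun i : ℕ => ‖(Ψ : ℤ → ℂ) (i : ℤ)‖)
    (fun _ _ => norm_nonneg _) (Finset.mem_range.2 (by omega))

theorem summable_lattice {N : ℕ} (hN : 0 < N) (κ : ℝ) :
    Summable fun k : ℤ => ((1 + |((k : ℝ) + κ) / N|) ^ 2)⁻¹ := by
  have hN' : (0 : ℝ) < N := by exact_mod_cast hN
  have h := ((Real.summable_one_div_int_add_rpow κ 2).2 (by norm_num)).mul_left ((N : ℝ) ^ 2)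
  refine h.of_norm_bounded_eventually ?_
  have hfin : {k : ℤ | (k : ℝ) + κ = 0}.Finite := by
    refine Set.Subsingleton.finite fun a ha b hb => ?_
    have : (a : ℝ) = b := by
      simp only [Set.mem_ofPred_eq] at ha hb
      linarith
    exact_mod_cast this
  filter_upwards [hfin.compl_mem_cofinite] with k hk
  have hk' : 0 < |(k : ℝ) + κ| := abs_pos.2 hk
  rw [Real.norm_of_nonneg (by positivity), Real.rpow_two, abs_div, abs_of_pos hN']
  rw [show (N : ℝ) ^ 2 * (1 / |(k : ℝ) + κ| ^ 2) = ((|(k : ℝ) + κ| / N) ^ 2)⁻¹ by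
    field_simp]
  gcongr
  linarith

theorem exists_seminorm_bound (f : 𝓢(ℝ, ℂ)) (x : ℝ) :
    ‖f x‖ ≤ (4 * (Finset.Iic ((2, 0) : ℕ × ℕ)).sup (schwartzSeminormFamily ℂ ℝ ℂ) f) *
      ((1 + |x|) ^ 2)⁻¹ := by
  have h := SchwartzMap.one_add_le_sup_seminorm_apply (𝕜 := ℂ) (m := (2, 0)) (k := 2) (n := 0)
    le_rfl le_rfl f x
  rw [norm_iteratedFDeriv_zero, Real.norm_eq_abs] at h
  rw [← div_eq_mul_inv, le_div_iff₀ (by positivity), mul_comm]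
  calc _ ≤ _ := h
    _ = _ := by norm_num; rfl

theorem summable_state {N : ℕ} (hN : 0 < N) {κ : ℝ × ℝ} (Ψ : State N κ) (f : 𝓢(ℝ, ℂ)) :
    Summable fun k : ℤ => (Ψ : ℤ → ℂ) k * f (((k : ℝ) + κ.1) / N) := by
  obtain ⟨C, hC, hb⟩ := exists_bound hN Ψ
  refine (((summable_lattice hN κ.1).mul_left
    (4 * (Finset.Iic ((2, 0) : ℕ × ℕ)).sup (schwartzSeminormFamily ℂ ℝ ℂ) f)).mul_left
      C).of_norm_bounded fun k => ?_
  rw [norm_mul]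
  exact mul_le_mul (hb k) (exists_seminorm_bound f _) (norm_nonneg _) hC

/-- The tempered distribution `∑ₖ Ψ(k) δ(q - (k + κ₁)/N)` (only used for `N ≥ 1`). -/
def toDist {N : ℕ} {κ : ℝ × ℝ} (Ψ : State N κ) : 𝓢'(ℝ, ℂ) :=
  ContinuousLinearMap.toPointwiseConvergenceCLM _ _ _ _ <|
    SchwartzMap.mkCLMtoNormedSpace (𝕜 := ℂ) (σ := RingHom.id ℂ)
      (fun f : 𝓢(ℝ, ℂ) => if 0 < N then
        ∑' k : ℤ, (Ψ : ℤ → ℂ) k * f (((k : ℝ) + κ.1) / N) else 0)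
      (by
        intro f g
        split_ifs with hN
        · rw [← (summable_state hN Ψ f).tsum_add (summable_state hN Ψ g)]
          simp [mul_add]
        · simp)
      (by
        intro c f
        split_ifs with hN
        · simp only [RingHom.id_apply, smul_eq_mul, ← tsum_mul_left]
          refine tsum_congr fun k => ?_
          simp only [smul_apply, smul_eq_mul]
          ring
        · simp)
      (by
        by_cases hN : 0 < N
        · obtain ⟨C, hC, hb⟩ := exists_bound hN Ψ
          have hs := summable_lattice hN κ.1
          refine ⟨Finset.Iic (2, 0), C * (4 * ∑' k : ℤ, ((1 + |((k : ℝ) + κ.1) / N|) ^ 2)⁻¹),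
            mul_nonneg hC (mul_nonneg (by norm_num) (tsum_nonneg fun k => by positivity)),
            fun f => ?_⟩
          rw [if_pos hN]
          refine (tsum_of_norm_bounded ((hs.mul_left
            (4 * (Finset.Iic ((2, 0) : ℕ × ℕ)).sup (schwartzSeminormFamily ℂ ℝ ℂ) f)).mul_left
              C).hasSum fun k => ?_).trans (le_of_eq ?_)
          · rw [norm_mul]
            exact mul_le_mul (hb k) (exists_seminorm_bound f _) (norm_nonneg _) hC
          · rw [tsum_mul_left, tsum_mul_left]
            ring
        · exact ⟨∅, 0, le_rfl, fun f => by simp [hN]⟩)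

theorem toDist_apply {N : ℕ} (hN : 0 < N) {κ : ℝ × ℝ} (Ψ : State N κ) (f : 𝓢(ℝ, ℂ)) :
    toDist Ψ f = ∑' k : ℤ, (Ψ : ℤ → ℂ) k * f (((k : ℝ) + κ.1) / N) :=
  if_pos hN

/-- The inner product `⟨ψ, φ⟩ = (1/N) ∑_{k=1}^N Ψ(k) conj Φ(k)` of `H_{N,κ}`. -/
def stateInner {N : ℕ} {κ : ℝ × ℝ} (Ψ Φ : State N κ) : ℂ :=
  1 / N * ∑ k ∈ Finset.Icc 1 N, (Ψ : ℤ → ℂ) k * (starRingEnd ℂ) ((Φ : ℤ → ℂ) k)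

/-- The translation `T̂_N(n) = T̂_{n/N}` at `h = 1/N` on `H_{N,κ}`, in terms of coefficients
(see `toDist_translationN`). -/
def translationN (N : ℕ) (κ : ℝ × ℝ) (n : ℤ × ℤ) : State N κ →ₗ[ℂ] State N κ where
  toFun Ψ := ⟨fun k => Complex.exp (2 * Real.pi * Complex.I *
      (n.2 * (k + κ.1 - n.1 / 2) / N)) * (Ψ : ℤ → ℂ) (k - n.1), by
    intro k
    have h1 : k + (N : ℤ) - n.1 = k - n.1 + N := by ring
    simp only [h1, Ψ.2 (k - n.1)]
    rcases Nat.eq_zero_or_pos N with hN | hN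
    · subst hN
      simp
    have hN' : (N : ℂ) ≠ 0 := by exact_mod_cast hN.ne'
    have h2 : 2 * Real.pi * Complex.I * (n.2 * (((k + (N : ℤ) : ℤ) : ℂ) + κ.1 - n.1 / 2) / N) =
        2 * Real.pi * Complex.I * (n.2 * (k + κ.1 - n.1 / 2) / N) +
          n.2 * (2 * Real.pi * Complex.I) := by
      push_cast
      field_simp
      ring
    rw [h2, Complex.exp_add, Complex.exp_int_mul_two_pi_mul_I]
    ring⟩
  map_add' Ψ Φ := by
    ext k
    simp [mul_add]
  map_smul' c Ψ := by
    ext k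
    simp only [SetLike.val_smul, Pi.smul_apply, smul_eq_mul, RingHom.id_apply]
    ring

theorem toDist_translationN {N : ℕ} (hN : 0 < N) {κ : ℝ × ℝ} (n : ℤ × ℤ) (Ψ : State N κ) :
    toDist (translationN N κ n Ψ) =
      translationDist (1 / N) ((n.1 : ℝ) / N, (n.2 : ℝ) / N) (toDist Ψ) := by
  have hN' : (N : ℝ) ≠ 0 := by exact_mod_cast hN.ne'
  ext f
  change _ = toDist Ψ (translation (1 / N) (-((n.1 : ℝ) / N), (n.2 : ℝ) / N) f)
  rw [toDist_apply hN, toDist_apply hN, ← (Equiv.addRight n.1).tsum_eq]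
  refine tsum_congr fun k => ?_
  rw [translation_apply]
  simp only [translationN, LinearMap.coe_mk, AddHom.coe_mk, Equiv.coe_addRight,
    add_sub_cancel_right]
  have h1 : (((k + n.1 : ℤ) : ℝ) + κ.1) / N = ((k : ℝ) + κ.1) / N - -((n.1 : ℝ) / N) := by
    push_cast
    field_simp
    ring
  have h2 : 2 * Real.pi * Complex.I * (n.2 * (((k + n.1 : ℤ) : ℂ) + κ.1 - n.1 / 2) / N) =
      Complex.I * ((2 * Real.pi / (1 / (N : ℝ)) * ((n.2 : ℝ) / N) *
        (((k : ℝ) + κ.1) / N - -((n.1 : ℝ) / N) / 2) : ℝ) : ℂ) := by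
    have hNC : (N : ℂ) ≠ 0 := by exact_mod_cast hN.ne'
    push_cast
    field_simp
    ring
  rw [h1, h2]
  ring

/-- `{φ_j}` is an eigenbasis of `M̂` in `H_{N,κ}`: `N` orthonormal vectors of this `N`-dimensional
space with `M̂ φ_j = e^{iθ_j} φ_j`. -/
structure IsEigenbasis (M : SL(2, ℤ)) {N : ℕ} {κ : ℝ × ℝ} (φ : Fin N → State N κ) : Prop where
  orthonormal : ∀ i j, stateInner (φ i) (φ j) = if i = j then 1 else 0
  eigen : ∀ j, ∃ θ : ℝ, quantization (1 / N) M (toDist (φ j)) =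
    Complex.exp (Complex.I * θ) • (toDist (φ j))

/-- `M̂` maps `H_{N,κ}` to itself. -/
def PreservesStates (M : SL(2, ℤ)) (N : ℕ) (κ : ℝ × ℝ) : Prop :=
  ∀ Ψ : State N κ, ∃ Φ : State N κ, quantization (1 / N) M (toDist Ψ) = toDist Φ

/-! ### Observables -/

/-- The torus `𝕋² = ℝ²/ℤ²`; its canonical measure has total mass one. -/
abbrev Torus : Type := UnitAddCircle × UnitAddCircle

/-- The open geodesic ball `B₂(x, r)` of the flat torus; the norm of `UnitAddCircle` is the distance
to `0`. -/
def disc (x : Torus) (r : ℝ) : Set Torus :=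
  {y | √(‖y.1 - x.1‖ ^ 2 + ‖y.2 - x.2‖ ^ 2) < r}

/-- Trigonometric polynomials `a(x) = ∑ₙ ã(n) e^{2πi (n ∧ x)}` on `𝕋²`, given by their finitely many
non-zero Fourier coefficients `ã(n)`. -/
abbrev TrigPoly : Type := (ℤ × ℤ) →₀ ℂ

/-- The character `x ↦ e^{2πi (n ∧ x)}`, where `n ∧ x = n₂ x₁ - n₁ x₂`. -/
def character (n : ℤ × ℤ) (x : Torus) : ℂ :=
  fourier n.2 x.1 * fourier (-n.1) x.2

/-- The value `a(x) = ∑ₙ ã(n) e^{2πi (n ∧ x)}`. -/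
def TrigPoly.eval (a : TrigPoly) (x : Torus) : ℂ :=
  a.sum fun n c => c * character n x

/-- The translate `a(· - x)`, with Fourier coefficients `e^{-2πi (n ∧ x)} ã(n)`. -/
def TrigPoly.translate (a : TrigPoly) (x : Torus) : TrigPoly :=
  Finsupp.onFinset a.support (fun n => character n (-x) * a n) fun _ hn =>
    Finsupp.mem_support_iff.2 (right_ne_zero_of_mul hn)

theorem TrigPoly.eval_translate (a : TrigPoly) (x y : Torus) :
    (a.translate x).eval y = a.eval (y - x) := by
  have hch : ∀ n : ℤ × ℤ, character n (-x) * character n y = character n (y - x) := by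
    intro n
    simp only [character, fourier_apply, Prod.fst_neg, Prod.snd_neg,
      sub_eq_neg_add, Prod.fst_add, Prod.snd_add, smul_add, AddCircle.toCircle_add, Circle.coe_mul]
    ring
  have hsub : (a.translate x).support ⊆ a.support := Finsupp.support_onFinset_subset
  rw [TrigPoly.eval, TrigPoly.eval, Finsupp.sum_of_support_subset _ hsub _ (by simp), Finsupp.sum]
  refine Finset.sum_congr rfl fun n _ => ?_
  rw [← hch n]
  simp only [TrigPoly.translate, Finsupp.onFinset_apply]
  ring

/-- The Weyl quantization `Op_N(a) = ∑ₙ ã(n) T̂_N(n)` on `H_{N,κ}`. -/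
def weylOp (N : ℕ) (κ : ℝ × ℝ) (a : TrigPoly) : State N κ →ₗ[ℂ] State N κ :=
  a.sum fun n c => c • translationN N κ n

/-- `(a_N^+)` and `(a_N^-)` are trigonometric majorants and minorants of degree less than `D(N)` of
the indicator functions of the discs `B₂(0, r(N))`: for all large `N` they are real-valued,
`a_N^- ≤ χ_{B₂(0, r)} ≤ a_N^+`, their Fourier coefficients vanish at `|n| ≥ D` and are
bounded by a constant times `r²`, and their integrals are `Vol(B₂(0, r)) + o(r²)`. -/
structure IsMajorantMinorant (r D : ℕ → ℝ) (aPlus aMinus : ℕ → TrigPoly) : Prop where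
  real : ∀ᶠ N in atTop, ∀ y : Torus, ((aPlus N).eval y).im = 0 ∧ ((aMinus N).eval y).im = 0
  majorant : ∀ᶠ N in atTop, ∀ y : Torus,
    (disc 0 (r N)).indicator (fun _ => (1 : ℝ)) y ≤ ((aPlus N).eval y).re
  minorant : ∀ᶠ N in atTop, ∀ y : Torus,
    ((aMinus N).eval y).re ≤ (disc 0 (r N)).indicator (fun _ => (1 : ℝ)) y
  degree : ∀ᶠ N in atTop, ∀ n : ℤ × ℤ, D N ≤ √((n.1 : ℝ) ^ 2 + (n.2 : ℝ) ^ 2) →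
    aPlus N n = 0 ∧ aMinus N n = 0
  coeff : ∃ c : ℝ, ∀ᶠ N in atTop, ∀ n : ℤ × ℤ,
    ‖aPlus N n‖ ≤ c * r N ^ 2 ∧ ‖aMinus N n‖ ≤ c * r N ^ 2
  integral_plus :
    (fun N => aPlus N 0 - (volume.real (disc 0 (r N)) : ℂ)) =o[atTop] fun N => r N ^ 2
  integral_minus :
    (fun N => aMinus N 0 - (volume.real (disc 0 (r N)) : ℂ)) =o[atTop] fun N => r N ^ 2

/-- Quantum ergodicity of the quantum cat map of `M` at scale `r = r(N)`, `N ∈ ℕ`, tested on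
`b^±_{x,r} = a_N^±(· - x)`: for every admissible choice of `κ` and every choice of eigenbases
there are sets `S(N) ⊆ {1, …, N}` of full density such that
`⟨Op_N(b^±_{x,r}) φ_j, φ_j⟩ = Vol(B₂(x, r)) + o(r²)` uniformly in `j ∈ S(N)` and `x ∈ 𝕋²`. -/
def QuantumErgodicityAtScale (M : SL(2, ℤ)) (r : ℕ → ℝ) (aPlus aMinus : ℕ → TrigPoly) : Prop :=
  ∀ κ : ℕ → ℝ × ℝ, (∀ N, 0 < N → PreservesStates M N (κ N)) →
  ∀ φ : (N : ℕ) → Fin N → State N (κ N), (∀ N, 0 < N → IsEigenbasis M (φ N)) →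
  ∃ S : (N : ℕ) → Finset (Fin N),
    Tendsto (fun N => ((S N).card : ℝ) / N) atTop (𝓝 1) ∧
    ∀ ε : ℝ, 0 < ε → ∀ᶠ N in atTop, ∀ j ∈ S N, ∀ x : Torus,
      ‖stateInner (weylOp N (κ N) ((aPlus N).translate x) (φ N j)) (φ N j) -
          (volume.real (disc x (r N)) : ℂ)‖ ≤ ε * r N ^ 2 ∧
      ‖stateInner (weylOp N (κ N) ((aMinus N).translate x) (φ N j)) (φ N j) -
          (volume.real (disc x (r N)) : ℂ)‖ ≤ ε * r N ^ 2

end QuantumCat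

end

/-!
The translations `T̂_N(n)` with `n` running over distinct points of an `M`-orbit modulo `N` are
orthogonal for the Hilbert–Schmidt inner product, and by the exact Egorov property they all have the
same diagonal matrix elements on eigenstates of `M̂`. Since the first `≍ log N` orbit points of a
small frequency are distinct modulo `N`, averaging over them bounds the quantum variance of
`T̂_N(n)` by `O(1 / log N)`. Summing over the `O(D²)` frequencies, Chebyshev's inequality gives a
set of eigenstates of full density on which the sum of all matrix elements is small; the condition
`D⁴ = o(log N)` is what makes this work, and translating the observable only changes phases.

Majorants and minorants are obtained by convolving slightly enlarged or shrunk discs with the kernel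
`|q(x₁)|² |q(x₂)|²`, where `q(t) = ∑ sin(πj/n) e^{2πijt}`. The first eigenvalue of the discrete
Dirichlet Laplacian shows that this kernel is concentrated at scale `1 / n`. Multiplying it by a
trigonometric polynomial of degree one that is positive only near `0` yields exact one-sided bounds.
-/

noncomputable section

namespace QuantumCat

section States

variable {N : ℕ} {κ : ℝ × ℝ}

theorem sum_Icc_add_one {F : ℤ → ℂ} (hF : Function.Periodic F N) :
    ∑ k ∈ Finset.Icc 1 N, F (k + 1) = ∑ k ∈ Finset.Icc 1 N, F k := by
  have telescope (n : ℕ) :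
      ∑ k ∈ Finset.Icc 1 n, F (k + 1) + F 1 = ∑ k ∈ Finset.Icc 1 n, F k + F (n + 1) := by
    induction n with
    | zero => simp
    | succ n ih =>
      rw [Finset.sum_Icc_succ_top (by omega), Finset.sum_Icc_succ_top (by omega)]
      push_cast
      linear_combination ih
  have hN := telescope N
  rw [add_comm (N : ℤ), hF] at hN
  exact add_right_cancel hN

theorem sum_Icc_add {F : ℤ → ℂ} (hF : Function.Periodic F N) (a : ℤ) :
    ∑ k ∈ Finset.Icc 1 N, F (k + a) = ∑ k ∈ Finset.Icc 1 N, F k := by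
  have shift (b : ℤ) :
      ∑ k ∈ Finset.Icc 1 N, F (k + (b + 1)) = ∑ k ∈ Finset.Icc 1 N, F (k + b) := by
    simpa only [add_assoc, add_comm b] using sum_Icc_add_one (hF.add_const b)
  induction a using Int.induction_on with
  | zero => simp
  | succ i ih => rw [shift, ih]
  | pred i ih => rw [← ih, ← shift, sub_add_cancel]

theorem mul_conj_periodic (Ψ Φ : State N κ) :
    Function.Periodic (fun k => (Ψ : ℤ → ℂ) k * (starRingEnd ℂ) ((Φ : ℤ → ℂ) k)) N := by
  have hphase : ‖Complex.exp (-2 * Real.pi * Complex.I * κ.2)‖ = 1 := by simp [Complex.norm_exp]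
  intro k
  simp only [Ψ.2 k, Φ.2 k, map_mul]
  rw [mul_mul_mul_comm, Complex.mul_conj, Complex.normSq_eq_norm_sq, hphase]
  simp

theorem stateInner_self (Ψ : State N κ) :
    stateInner Ψ Ψ = ((1 / N * ∑ k ∈ Finset.Icc 1 N, ‖(Ψ : ℤ → ℂ) k‖ ^ 2 : ℝ) : ℂ) := by
  simp only [stateInner, Complex.mul_conj, Complex.normSq_eq_norm_sq]
  push_cast
  rfl

variable [NeZero N]

theorem state_ext_Icc {Ψ Φ : State N κ}
    (h : ∀ k ∈ Finset.Icc 1 N, (Ψ : ℤ → ℂ) k = (Φ : ℤ → ℂ) k) : Ψ = Φ := by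
  have hN : (0 : ℤ) < N := by exact_mod_cast NeZero.pos N
  have hper : Function.Periodic (fun k => (Ψ - Φ : ℤ → ℂ) k = 0) (N : ℤ) := fun k => by
    simpa [Complex.exp_ne_zero] using
      congrArg (· = (0 : ℂ)) ((Ψ - Φ).2 k)
  ext k
  obtain ⟨l, ⟨hl0, hlN⟩, hl⟩ := hper.exists_mem_Ioc hN k 0
  have hlmem : l.toNat ∈ Finset.Icc 1 N := Finset.mem_Icc.2 (by omega)
  have := h _ hlmem
  rw [Int.toNat_of_nonneg hl0.le] at this
  exact sub_eq_zero.1 (hl.mpr (sub_eq_zero.2 this))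

theorem injective_funLeft_Icc : Function.Injective
    (LinearMap.funLeft ℂ ℂ (fun k : Finset.Icc 1 N => ((k : ℕ) : ℤ)) ∘ₗ (State N κ).subtype) :=
  fun _ _ h => state_ext_Icc fun k hk => congrFun h ⟨k, hk⟩

instance : FiniteDimensional ℂ (State N κ) :=
  FiniteDimensional.of_injective _ injective_funLeft_Icc

theorem finrank_state_le : Module.finrank ℂ (State N κ) ≤ N := by
  simpa using LinearMap.finrank_le_finrank_of_injective (injective_funLeft_Icc (κ := κ) (N := N))

/-- `stateInner` as an inner product; Mathlib's inner products are linear in the second variable,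
hence the swap. -/
@[reducible]
def stateInnerCore (N : ℕ) [NeZero N] (κ : ℝ × ℝ) : InnerProductSpace.Core ℂ (State N κ) where
  inner Ψ Φ := stateInner Φ Ψ
  conj_inner_symm Ψ Φ := by simp [stateInner, mul_comm]
  re_inner_nonneg Ψ := by
    rw [stateInner_self]
    exact mul_nonneg (by positivity) (by positivity)
  add_left Ψ Ψ' Φ := by simp [stateInner, mul_add, Finset.sum_add_distrib]
  smul_left Ψ Φ c := by simp [stateInner, Finset.mul_sum, mul_left_comm]
  definite Ψ h := by
    rw [stateInner_self, Complex.ofReal_eq_zero, mul_eq_zero_iff_left (by simp [NeZero.ne N]),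
      Finset.sum_eq_zero_iff_of_nonneg (by intros; positivity)] at h
    exact state_ext_Icc fun k hk => by simpa using h k hk

instance : NormedAddCommGroup (State N κ) := (stateInnerCore N κ).toNormedAddCommGroup

instance : InnerProductSpace ℂ (State N κ) := .ofCore (stateInnerCore N κ).toCore

theorem inner_eq_stateInner (Ψ Φ : State N κ) : inner ℂ Ψ Φ = stateInner Φ Ψ := rfl

end States

section Translations

variable {N : ℕ} {κ : ℝ × ℝ}

theorem translationN_apply (n : ℤ × ℤ) (Ψ : State N κ) (k : ℤ) :
    (translationN N κ n Ψ : ℤ → ℂ) k = Complex.exp (2 * Real.pi * Complex.I *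
      (n.2 * (k + κ.1 - n.1 / 2) / N)) * (Ψ : ℤ → ℂ) (k - n.1) := rfl

theorem translationN_zero : translationN N κ 0 = 1 := by
  ext Ψ k
  simp [translationN_apply]

variable [NeZero N]

/-- The phase in the composition law `translationN_mul` of the phase-space translations. -/
def weylPhase (N : ℕ) (m n : ℤ × ℤ) : ℂ :=
  Complex.exp (2 * Real.pi * Complex.I * ((m.2 * n.1 - m.1 * n.2) / (2 * N)))

theorem translationN_mul (m n : ℤ × ℤ) :
    translationN N κ m * translationN N κ n = weylPhase N m n • translationN N κ (m + n) := by
  have hN : (N : ℂ) ≠ 0 := NeZero.ne _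
  ext Ψ k
  simp only [Module.End.mul_apply, LinearMap.smul_apply, SetLike.val_smul, Pi.smul_apply,
    translationN_apply, smul_eq_mul, ← mul_assoc, weylPhase, ← Complex.exp_add, sub_sub,
    Prod.fst_add, Prod.snd_add]
  congr 2
  push_cast
  field_simp
  ring

theorem translationN_mul_neg (n : ℤ × ℤ) : translationN N κ n * translationN N κ (-n) = 1 := by
  have hphase : weylPhase N n (-n) = 1 := by simp [weylPhase, mul_comm]
  rw [translationN_mul, add_neg_cancel, translationN_zero, hphase, one_smul]

theorem inner_translationN (n : ℤ × ℤ) (Ψ Φ : State N κ) :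
    inner ℂ (translationN N κ n Ψ) Φ = inner ℂ Ψ (translationN N κ (-n) Φ) := by
  simp only [inner_eq_stateInner, stateInner]
  rw [← sum_Icc_add (mul_conj_periodic Φ (translationN N κ n Ψ)) n.1]
  congr 1
  refine Finset.sum_congr rfl fun k _ => ?_
  simp only [translationN_apply, add_sub_cancel_right, Prod.fst_neg, Prod.snd_neg, sub_neg_eq_add,
    map_mul, ← Complex.exp_conj]
  rw [← mul_assoc, mul_comm (_ * _ : ℂ), mul_comm (Complex.exp _), mul_comm]
  congr 3
  simp [map_ofNat]
  ring

theorem translationN_mul_mul_neg (m n : ℤ × ℤ) :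
    translationN N κ m * translationN N κ n * translationN N κ (-m) =
      Complex.exp (2 * Real.pi * Complex.I * ((m.2 * n.1 - m.1 * n.2 : ℤ) / N)) •
        translationN N κ n := by
  have hN : (N : ℂ) ≠ 0 := NeZero.ne _
  rw [translationN_mul, smul_mul_assoc, translationN_mul, smul_smul, add_neg_cancel_comm,
    weylPhase, weylPhase, ← Complex.exp_add]
  congr 2
  simp only [Prod.fst_add, Prod.snd_add, Prod.fst_neg, Prod.snd_neg]
  push_cast
  field_simp
  ring

theorem dvd_of_exp_div_eq_one {a : ℤ} (ha : Complex.exp (2 * Real.pi * Complex.I * (a / N)) = 1) :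
    (N : ℤ) ∣ a := by
  have hN : (N : ℂ) ≠ 0 := NeZero.ne _
  obtain ⟨b, hb⟩ := Complex.exp_eq_one_iff.1 ha
  rw [mul_comm (b : ℂ)] at hb
  have hab := mul_left_cancel₀ Complex.two_pi_I_ne_zero hb
  rw [div_eq_iff hN, mul_comm] at hab
  exact ⟨b, by exact_mod_cast hab⟩

theorem dvd_of_trace_translationN_ne_zero {n : ℤ × ℤ}
    (hn : LinearMap.trace ℂ (State N κ) (translationN N κ n) ≠ 0) (m : ℤ × ℤ) :
    (N : ℤ) ∣ m.2 * n.1 - m.1 * n.2 := by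
  have hconj := LinearMap.trace_mul_comm ℂ (translationN N κ m * translationN N κ n)
    (translationN N κ (-m))
  have hinv : translationN N κ (-m) * translationN N κ m = 1 := by
    simpa using translationN_mul_neg (κ := κ) (N := N) (-m)
  rw [translationN_mul_mul_neg, ← mul_assoc, hinv, one_mul, map_smul, smul_eq_mul] at hconj
  exact dvd_of_exp_div_eq_one (mul_right_cancel₀ hn (hconj.trans (one_mul _).symm))

theorem trace_translationN {n : ℤ × ℤ} (hn : ¬ (N : ℤ × ℤ) ∣ n) :
    LinearMap.trace ℂ (State N κ) (translationN N κ n) = 0 := by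
  by_contra h
  exact hn (prod_dvd_iff.2 ⟨by simpa using dvd_of_trace_translationN_ne_zero h (0, 1),
    by simpa using dvd_of_trace_translationN_ne_zero h (1, 0)⟩)

end Translations

section Egorov

/-- The action of `M ∈ SL(2, ℤ)` on `ℤ²`. -/
def latticeMap (M : SL(2, ℤ)) (n : ℤ × ℤ) : ℤ × ℤ :=
  (M 0 0 * n.1 + M 0 1 * n.2, M 1 0 * n.1 + M 1 1 * n.2)

theorem det_entries (M : SL(2, ℤ)) : M 0 0 * M 1 1 - M 0 1 * M 1 0 = 1 := by
  have hdet := M.2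
  rwa [Matrix.det_fin_two] at hdet

theorem kernel_translation {h A B C D : ℝ} (hh : h ≠ 0) (hB : B ≠ 0) (hdet : A * D - B * C = 1)
    (v : ℝ × ℝ) (q q' : ℝ) :
    kernel h A B D q q' *
        Complex.exp (Complex.I * (2 * Real.pi / h * v.2 * (q' - v.1 / 2) : ℝ)) =
      Complex.exp (Complex.I * (2 * Real.pi / h * (C * v.1 + D * v.2) *
        (q - (A * v.1 + B * v.2) / 2) : ℝ)) *
        kernel h A B D (q - (A * v.1 + B * v.2)) (q' - v.1) := by
  simp only [kernel]
  rw [mul_assoc, mul_left_comm (Complex.exp _), ← Complex.exp_add, ← Complex.exp_add, ← mul_add,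
    ← mul_add, ← Complex.ofReal_add, ← Complex.ofReal_add]
  congr 4
  have hC : C = (A * D - 1) / B := by
    field_simp
    linarith
  rw [hC]
  field_simp
  ring

theorem metaplectic_translation {h A B C D : ℝ} (hh : h ≠ 0) (hB : B ≠ 0) (hdet : A * D - B * C = 1)
    (v : ℝ × ℝ) (f : 𝓢(ℝ, ℂ)) :
    metaplectic h A B D (translation h v f) =
      translation h (A * v.1 + B * v.2, C * v.1 + D * v.2) (metaplectic h A B D f) := by
  ext q
  rw [metaplectic_apply hh hB, translation_apply, metaplectic_apply hh hB, ← integral_const_mul]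
  refine Eq.trans ?_ (integral_sub_right_eq_self _ v.1)
  refine integral_congr_ae (Eventually.of_forall fun q' => ?_)
  dsimp only
  rw [translation_apply, ← mul_assoc, ← mul_assoc, kernel_translation hh hB hdet]

theorem quantization_translationDist {M : SL(2, ℤ)} (hB : M 0 1 ≠ 0) {h : ℝ} (hh : h ≠ 0)
    (v : ℝ × ℝ) (u : 𝓢'(ℝ, ℂ)) :
    quantization h M (translationDist h v u) =
      translationDist h (M 0 0 * v.1 + M 0 1 * v.2, M 1 0 * v.1 + M 1 1 * v.2)
        (quantization h M u) := by
  ext f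
  change u (translation h (-v.1, v.2) (metaplectic h (M 1 1) (M 0 1) (M 0 0) f)) =
    u (metaplectic h (M 1 1) (M 0 1) (M 0 0) (translation h
      (-(M 0 0 * v.1 + M 0 1 * v.2), M 1 0 * v.1 + M 1 1 * v.2) f))
  have hdet : (M 0 0 : ℝ) * M 1 1 - M 0 1 * M 1 0 = 1 := by exact_mod_cast det_entries M
  rw [metaplectic_translation (C := M 1 0) hh (by exact_mod_cast hB) (by linarith)]
  congr 3
  ext
  · linear_combination v.1 * hdet
  · linear_combination (-v.2) * hdet

variable {N : ℕ} [NeZero N] {κ : ℝ × ℝ}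

theorem quantization_toDist_translationN {M : SL(2, ℤ)} (hB : M 0 1 ≠ 0) (n : ℤ × ℤ)
    (Ψ : State N κ) :
    quantization (1 / N) M (toDist (translationN N κ n Ψ)) =
      translationDist (1 / N) ((latticeMap M n).1 / N, (latticeMap M n).2 / N)
        (quantization (1 / N) M (toDist Ψ)) := by
  have hN : (1 / N : ℝ) ≠ 0 := one_div_ne_zero (NeZero.ne _)
  rw [toDist_translationN (NeZero.pos N), quantization_translationDist hB hN]
  congr 2
  simp only [latticeMap]
  push_cast
  ext <;> ring

/-- `toDist` as a linear map. -/
def toDistLinear (N : ℕ) [NeZero N] (κ : ℝ × ℝ) : State N κ →ₗ[ℂ] 𝓢'(ℝ, ℂ) where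
  toFun := toDist
  map_add' Ψ Φ := by
    ext g
    change _ = toDist Ψ g + toDist Φ g
    simp only [toDist_apply (NeZero.pos N), Submodule.coe_add, Pi.add_apply, add_mul]
    exact (summable_state (NeZero.pos N) Ψ g).tsum_add (summable_state (NeZero.pos N) Φ g)
  map_smul' c Ψ := by
    ext g
    change _ = c * toDist Ψ g
    simp only [toDist_apply (NeZero.pos N), SetLike.val_smul, Pi.smul_apply, smul_eq_mul, mul_assoc,
      tsum_mul_left]

theorem toDistLinear_apply (Ψ : State N κ) : toDistLinear N κ Ψ = toDist Ψ := rfl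

theorem exists_schwartz_sampling (N : ℕ) [NeZero N] (κ : ℝ × ℝ) (k : ℤ) :
    ∃ g : 𝓢(ℝ, ℂ), ∀ l : ℤ, g ((l + κ.1) / N) = if l = k then 1 else 0 := by
  have hN : (0 : ℝ) < N := by exact_mod_cast NeZero.pos N
  let b : ContDiffBump (((k : ℝ) + κ.1) / N) :=
    ⟨1 / (4 * N), 1 / (2 * N), by positivity, by gcongr; norm_num⟩
  have hb : HasCompactSupport (fun x => (b x : ℂ)) :=
    b.hasCompactSupport.comp_left (g := fun x : ℝ => (x : ℂ)) rfl
  refine ⟨hb.toSchwartzMap (Complex.ofRealCLM.contDiff.comp b.contDiff), fun l => ?_⟩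
  change ((b ((l + κ.1) / N) : ℝ) : ℂ) = _
  split_ifs with hl
  · rw [hl, b.one_of_mem_closedBall (by simp [b]), Complex.ofReal_one]
  · rw [b.zero_of_le_dist, Complex.ofReal_zero]
    have hlk : (1 : ℝ) ≤ |(l : ℝ) - k| := by exact_mod_cast Int.one_le_abs (sub_ne_zero.2 hl)
    change 1 / (2 * (N : ℝ)) ≤ _
    rw [Real.dist_eq, ← sub_div, add_sub_add_right_eq_sub, abs_div, abs_of_pos hN,
      div_le_div_iff₀ (by positivity) hN]
    nlinarith

theorem toDist_injective : Function.Injective (toDist : State N κ → 𝓢'(ℝ, ℂ)) := by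
  intro Ψ Φ h
  ext k
  obtain ⟨g, hg⟩ := exists_schwartz_sampling N κ k
  simpa [toDist_apply (NeZero.pos N), hg] using congrArg (fun u => u g) h

end Egorov

section Eigenbasis

variable {M : SL(2, ℤ)} {N : ℕ} [NeZero N] {κ : ℝ × ℝ} {φ : Fin N → State N κ}

namespace IsEigenbasis

theorem orthonormal_inner (hφ : IsEigenbasis M φ) : Orthonormal ℂ φ :=
  orthonormal_iff_ite.2 fun i j => by
    rw [inner_eq_stateInner, hφ.orthonormal]
    simp only [eq_comm]

/-- An eigenbasis as an orthonormal basis of the space of states. -/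
def orthonormalBasis (hφ : IsEigenbasis M φ) : OrthonormalBasis (Fin N) ℂ (State N κ) :=
  .mk hφ.orthonormal_inner <| ge_of_eq <|
    hφ.orthonormal_inner.linearIndependent.span_eq_top_of_card_eq_finrank' <|
      hφ.orthonormal_inner.linearIndependent.fintype_card_le_finrank.antisymm <| by
        simpa using finrank_state_le

theorem orthonormalBasis_apply (hφ : IsEigenbasis M φ) (j : Fin N) :
    hφ.orthonormalBasis j = φ j := by
  simp [orthonormalBasis]

theorem toDist_eq_sum (hφ : IsEigenbasis M φ) (Ψ : State N κ) :
    toDist Ψ = ∑ i, inner ℂ (φ i) Ψ • toDist (φ i) := by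
  conv_lhs => rw [← toDistLinear_apply, ← hφ.orthonormalBasis.sum_repr' Ψ]
  simp only [map_sum, map_smul, orthonormalBasis_apply, toDistLinear_apply]

theorem inner_translationN_latticeMap (hφ : IsEigenbasis M φ) (hB : M 0 1 ≠ 0) (n : ℤ × ℤ)
    (j : Fin N) :
    inner ℂ (φ j) (translationN N κ (latticeMap M n) (φ j)) =
      inner ℂ (φ j) (translationN N κ n (φ j)) := by
  choose θ hθ using hφ.eigen
  let lam (i : Fin N) : ℂ := Complex.exp (Complex.I * θ i)
  have egorov : toDist (lam j • translationN N κ (latticeMap M n) (φ j)) =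
      toDist (∑ i, (inner ℂ (φ i) (translationN N κ n (φ j)) * lam i) • φ i) := by
    calc toDist (lam j • translationN N κ (latticeMap M n) (φ j))
        = translationDist (1 / N) ((latticeMap M n).1 / N, (latticeMap M n).2 / N)
            (quantization (1 / N) M (toDist (φ j))) := by
          rw [hθ, map_smul, ← toDist_translationN (NeZero.pos N), ← toDistLinear_apply, map_smul,
            toDistLinear_apply]
      _ = quantization (1 / N) M (toDist (translationN N κ n (φ j))) :=
          (quantization_toDist_translationN hB n (φ j)).symm
      _ = _ := by
          rw [hφ.toDist_eq_sum (translationN N κ n (φ j)), map_sum, ← toDistLinear_apply (∑ i, _),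
            map_sum]
          simp only [map_smul, hθ, smul_smul, toDistLinear_apply, lam]
  have hinner := congrArg (inner ℂ (φ j)) (toDist_injective egorov)
  rw [inner_smul_right, hφ.orthonormal_inner.inner_right_fintype, mul_comm] at hinner
  exact mul_right_cancel₀ (Complex.exp_ne_zero _) hinner

theorem inner_translationN_iterate (hφ : IsEigenbasis M φ) (hB : M 0 1 ≠ 0) (n : ℤ × ℤ)
    (t : ℕ) (j : Fin N) :
    inner ℂ (φ j) (translationN N κ ((latticeMap M)^[t] n) (φ j)) =
      inner ℂ (φ j) (translationN N κ n (φ j)) := by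
  induction t with
  | zero => rfl
  | succ t ih => rw [Function.iterate_succ_apply', hφ.inner_translationN_latticeMap hB, ih]

end IsEigenbasis

theorem sum_inner_translationN (b : OrthonormalBasis (Fin N) ℂ (State N κ)) (m n : ℤ × ℤ) :
    ∑ j, inner ℂ (translationN N κ m (b j)) (translationN N κ n (b j)) =
      LinearMap.trace ℂ (State N κ) (translationN N κ (-m) * translationN N κ n) := by
  rw [LinearMap.trace_eq_sum_inner _ b]
  simp only [inner_translationN, Module.End.mul_apply]

theorem sum_norm_sq_sum_translationN (b : OrthonormalBasis (Fin N) ℂ (State N κ)) {T : ℕ}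
    {p : ℕ → ℤ × ℤ} (hp : ∀ s < T, ∀ t < T, s ≠ t → ¬ (N : ℤ × ℤ) ∣ p s - p t) :
    ∑ j, ‖∑ t ∈ Finset.range T, translationN N κ (p t) (b j)‖ ^ 2 = T * N := by
  have hdiag (s : ℕ) :
      ∑ j, inner ℂ (translationN N κ (p s) (b j)) (translationN N κ (p s) (b j)) = (N : ℂ) := by
    rw [sum_inner_translationN]
    conv_lhs => rw [← neg_neg (p s), neg_neg (-p s), translationN_mul_neg]
    rw [LinearMap.trace_one, Module.finrank_eq_card_basis b.toBasis, Fintype.card_fin]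
  have hoff {s t : ℕ} (hs : s < T) (ht : t < T) (hst : t ≠ s) :
      ∑ j, inner ℂ (translationN N κ (p s) (b j)) (translationN N κ (p t) (b j)) = 0 := by
    rw [sum_inner_translationN, translationN_mul, map_smul,
      trace_translationN (by simpa [neg_add_eq_sub] using hp t ht s hs hst), smul_zero]
  have hsum : ∑ j, inner ℂ (∑ t ∈ Finset.range T, translationN N κ (p t) (b j))
      (∑ t ∈ Finset.range T, translationN N κ (p t) (b j)) = (T * N : ℂ) := by
    calc _ = ∑ j, ∑ s ∈ Finset.range T, ∑ t ∈ Finset.range T,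
          inner ℂ (translationN N κ (p s) (b j)) (translationN N κ (p t) (b j)) :=
          Finset.sum_congr rfl fun j _ => by
            rw [sum_inner]
            exact Finset.sum_congr rfl fun _ _ => inner_sum _ _ _
      _ = ∑ s ∈ Finset.range T, ∑ t ∈ Finset.range T,
          ∑ j, inner ℂ (translationN N κ (p s) (b j)) (translationN N κ (p t) (b j)) := by
          rw [Finset.sum_comm]
          exact Finset.sum_congr rfl fun _ _ => Finset.sum_comm
      _ = ∑ _ ∈ Finset.range T, (N : ℂ) := Finset.sum_congr rfl fun _ hs => by
          rw [Finset.sum_eq_single_of_mem _ hs fun t ht => hoff (Finset.mem_range.1 hs)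
            (Finset.mem_range.1 ht), hdiag]
      _ = T * N := by simp
  simp only [inner_self_eq_norm_sq_to_K] at hsum
  apply Complex.ofReal_injective
  push_cast
  exact hsum

theorem IsEigenbasis.sum_norm_sq_le (hφ : IsEigenbasis M φ) (hB : M 0 1 ≠ 0) (n : ℤ × ℤ) {T : ℕ}
    (hT : 0 < T) (hdist : ∀ s < T, ∀ t < T, s ≠ t →
      ¬ (N : ℤ × ℤ) ∣ (latticeMap M)^[s] n - (latticeMap M)^[t] n) :
    ∑ j, ‖inner ℂ (φ j) (translationN N κ n (φ j))‖ ^ 2 ≤ N / T := by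
  have hTR : (0 : ℝ) < T := by exact_mod_cast hT
  let A (j : Fin N) : State N κ :=
    ∑ t ∈ Finset.range T, translationN N κ ((latticeMap M)^[t] n) (φ j)
  have hA (j : Fin N) : T * ‖inner ℂ (φ j) (translationN N κ n (φ j))‖ ≤ ‖A j‖ := by
    have := norm_inner_le_norm (𝕜 := ℂ) (φ j) (A j)
    simpa [A, inner_sum, hφ.inner_translationN_iterate hB, hφ.orthonormal_inner.1 j] using this
  have hsum : ∑ j, ‖A j‖ ^ 2 = T * N := by
    simpa only [hφ.orthonormalBasis_apply] using
      sum_norm_sq_sum_translationN hφ.orthonormalBasis hdist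
  have key : (T : ℝ) ^ 2 * ∑ j, ‖inner ℂ (φ j) (translationN N κ n (φ j))‖ ^ 2 ≤ T * N := by
    rw [← hsum, Finset.mul_sum]
    refine Finset.sum_le_sum fun j _ => ?_
    rw [← mul_pow]
    exact pow_le_pow_left₀ (by positivity) (hA j) 2
  rw [le_div_iff₀ hTR]
  nlinarith

end Eigenbasis

section Orbits

theorem eq_zero_of_recurrence_of_periodic {𝕜 E : Type*} [NormedRing 𝕜] [NormedAddCommGroup E]
    [Module 𝕜 E] [NormSMulClass 𝕜 E] {u : ℕ → E} {τ : 𝕜} (hτ : 2 < ‖τ‖)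
    (hu : ∀ t, u (t + 2) = τ • u (t + 1) - u t) {k : ℕ} (hk : 0 < k)
    (hper : Function.Periodic u k) (t : ℕ) : u t = 0 := by
  obtain ⟨i, -, hi⟩ := (Finset.range k).exists_max_image (‖u ·‖) ⟨0, by simpa using hk⟩
  have hmax (t : ℕ) : ‖u t‖ ≤ ‖u i‖ := by
    simpa only [hper.map_mod_nat] using hi (t % k) (Finset.mem_range.2 (Nat.mod_lt t hk))
  have hrec : τ • u i = u (i + k - 1 + 2) + u (i + k - 1) := by
    rw [hu, show i + k - 1 + 1 = i + k by omega, hper, sub_add_cancel]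
  have hle : ‖τ‖ * ‖u i‖ ≤ ‖u i‖ + ‖u i‖ := by
    rw [← norm_smul, hrec]
    exact norm_add_le_of_le (hmax _) (hmax _)
  have hzero : ‖u i‖ = 0 := by nlinarith [norm_nonneg (u i)]
  exact norm_le_zero_iff.1 (hzero ▸ hmax t)

variable {M : SL(2, ℤ)}

theorem latticeMap_latticeMap (M : SL(2, ℤ)) (n : ℤ × ℤ) :
    latticeMap M (latticeMap M n) =
      (M : Matrix (Fin 2) (Fin 2) ℤ).trace • latticeMap M n - n := by
  have hdet := det_entries M
  rw [Matrix.trace_fin_two]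
  ext
  · simp only [latticeMap, Prod.fst_sub, Prod.smul_fst, smul_eq_mul]
    linear_combination (-n.1) * hdet
  · simp only [latticeMap, Prod.snd_sub, Prod.smul_snd, smul_eq_mul]
    linear_combination (-n.2) * hdet

theorem latticeMap_injective (M : SL(2, ℤ)) : Function.Injective (latticeMap M) := by
  intro m n hmn
  have hdet := det_entries M
  obtain ⟨hfst, hsnd⟩ := Prod.ext_iff.1 hmn
  simp only [latticeMap] at hfst hsnd
  ext
  · linear_combination (-(m.1 - n.1)) * hdet + M 1 1 * hfst - M 0 1 * hsnd
  · linear_combination (-(m.2 - n.2)) * hdet + M 0 0 * hsnd - M 1 0 * hfst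

theorem iterate_latticeMap_ne (hM : 2 < |(M : Matrix (Fin 2) (Fin 2) ℤ).trace|) {n : ℤ × ℤ}
    (hn : n ≠ 0) {s t : ℕ} (hst : s < t) : (latticeMap M)^[s] n ≠ (latticeMap M)^[t] n := by
  intro h
  let u (i : ℕ) : ℤ × ℤ := (latticeMap M)^[s + i] n
  have hτ : 2 < ‖(M : Matrix (Fin 2) (Fin 2) ℤ).trace‖ := by
    rw [Int.norm_eq_abs]
    exact_mod_cast hM
  have hrec (i : ℕ) : u (i + 2) = (M : Matrix (Fin 2) (Fin 2) ℤ).trace • u (i + 1) - u i := by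
    simp only [u, ← add_assoc, Function.iterate_succ_apply', ← latticeMap_latticeMap]
  have hper : Function.Periodic u (t - s) := fun i => by
    simp only [u]
    rw [show s + (i + (t - s)) = i + t by omega, Function.iterate_add_apply, ← h,
      ← Function.iterate_add_apply, add_comm]
  have hzero : (latticeMap M)^[s] n = 0 :=
    eq_zero_of_recurrence_of_periodic hτ hrec (Nat.sub_pos_of_lt hst) hper 0
  have hfix : (latticeMap M)^[s] 0 = 0 := Function.iterate_fixed (by simp [latticeMap]) s
  exact hn ((latticeMap_injective M).iterate s (hzero.trans hfix.symm))

/-- A bound for the expansion rate of `latticeMap M`; the summand `2` keeps its logarithm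
positive. -/
def expansion (M : SL(2, ℤ)) : ℝ := 2 + ‖M 0 0‖ + ‖M 0 1‖ + ‖M 1 0‖ + ‖M 1 1‖

theorem two_le_expansion (M : SL(2, ℤ)) : 2 ≤ expansion M := by
  unfold expansion
  linarith [norm_nonneg (M 0 0), norm_nonneg (M 0 1), norm_nonneg (M 1 0), norm_nonneg (M 1 1)]

theorem norm_latticeMap_le (M : SL(2, ℤ)) (n : ℤ × ℤ) :
    ‖latticeMap M n‖ ≤ expansion M * ‖n‖ := by
  have hrow (a b : ℤ) (hab : ‖a‖ + ‖b‖ ≤ expansion M) :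
      ‖a * n.1 + b * n.2‖ ≤ expansion M * ‖n‖ := by
    calc ‖a * n.1 + b * n.2‖ ≤ ‖a‖ * ‖n‖ + ‖b‖ * ‖n‖ :=
          norm_add_le_of_le ((norm_mul_le _ _).trans (by gcongr; exact norm_fst_le n))
            ((norm_mul_le _ _).trans (by gcongr; exact norm_snd_le n))
      _ = (‖a‖ + ‖b‖) * ‖n‖ := (add_mul _ _ _).symm
      _ ≤ expansion M * ‖n‖ := by gcongr
  have hnonneg (i j : Fin 2) := norm_nonneg (M i j)
  refine max_le (hrow _ _ ?_) (hrow _ _ ?_) <;> unfold expansion <;>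
    linarith [hnonneg 0 0, hnonneg 0 1, hnonneg 1 0, hnonneg 1 1]

theorem norm_iterate_latticeMap_le (M : SL(2, ℤ)) (n : ℤ × ℤ) (t : ℕ) :
    ‖(latticeMap M)^[t] n‖ ≤ expansion M ^ t * ‖n‖ := by
  have hK : 0 ≤ expansion M := by linarith [two_le_expansion M]
  induction t with
  | zero => simp
  | succ t ih =>
    rw [Function.iterate_succ_apply', pow_succ', mul_assoc]
    exact (norm_latticeMap_le M _).trans (by gcongr)

theorem eq_zero_of_natCast_dvd_of_norm_lt {N : ℕ} {n : ℤ × ℤ} (hdvd : (N : ℤ × ℤ) ∣ n)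
    (hn : ‖n‖ < N) : n = 0 := by
  have hcoord {a : ℤ} (ha : (N : ℤ) ∣ a) (hle : ‖a‖ ≤ ‖n‖) : a = 0 := by
    refine Int.eq_zero_of_abs_lt_dvd ha ?_
    rw [Int.norm_eq_abs] at hle
    exact_mod_cast hle.trans_lt hn
  obtain ⟨hfst, hsnd⟩ := prod_dvd_iff.1 hdvd
  exact Prod.ext (hcoord hfst (norm_fst_le n)) (hcoord hsnd (norm_snd_le n))

theorem iterate_latticeMap_not_dvd (hM : 2 < |(M : Matrix (Fin 2) (Fin 2) ℤ).trace|) {n : ℤ × ℤ}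
    (hn : n ≠ 0) {N T : ℕ} (hT : ∀ t < T, 2 * (expansion M ^ t * ‖n‖) < N) :
    ∀ s < T, ∀ t < T, s ≠ t →
      ¬ (N : ℤ × ℤ) ∣ (latticeMap M)^[s] n - (latticeMap M)^[t] n := by
  intro s hs t ht hst hdvd
  have hlt : ‖(latticeMap M)^[s] n - (latticeMap M)^[t] n‖ < N := by
    refine (norm_sub_le_of_le (norm_iterate_latticeMap_le M n s)
      (norm_iterate_latticeMap_le M n t)).trans_lt ?_
    linarith [hT s hs, hT t ht]
  have heq := sub_eq_zero.1 (eq_zero_of_natCast_dvd_of_norm_lt hdvd hlt)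
  rcases hst.lt_or_gt with h | h
  · exact iterate_latticeMap_ne hM hn h heq
  · exact iterate_latticeMap_ne hM hn h heq.symm

theorem upperRight_ne_zero (hM : 2 < |(M : Matrix (Fin 2) (Fin 2) ℤ).trace|) : M 0 1 ≠ 0 := by
  intro h
  have hdet := det_entries M
  rw [h, zero_mul, sub_zero] at hdet
  rw [Matrix.trace_fin_two] at hM
  rcases Int.eq_one_or_neg_one_of_mul_eq_one' hdet with ⟨h₀, h₁⟩ | ⟨h₀, h₁⟩ <;>
    rw [h₀, h₁] at hM <;> norm_num at hM

end Orbits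

section Variance

theorem pow_le_sqrt_of_le_log_div {K x : ℝ} (hK : 1 < K) (hx : 0 < x) {t : ℕ}
    (ht : t ≤ Real.log x / (2 * Real.log K)) : K ^ t ≤ √x := by
  have hlogK : 0 < Real.log K := Real.log_pos hK
  rw [le_div_iff₀ (by positivity)] at ht
  rw [← Real.log_le_log_iff (by positivity) (by positivity), Real.log_pow, Real.log_sqrt hx.le]
  linarith

theorem IsEigenbasis.sum_norm_sq_le_div_log {M : SL(2, ℤ)} {N : ℕ} [NeZero N] {κ : ℝ × ℝ}
    {φ : Fin N → State N κ} (hφ : IsEigenbasis M φ)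
    (hM : 2 < |(M : Matrix (Fin 2) (Fin 2) ℤ).trace|) (hN : expansion M ^ 2 ≤ N) {n : ℤ × ℤ}
    (hn : n ≠ 0) (hnN : 4 * ‖n‖ ≤ √N) :
    ∑ j, ‖inner ℂ (φ j) (translationN N κ n (φ j))‖ ^ 2 ≤
      4 * Real.log (expansion M) * N / Real.log N := by
  have hNR : (0 : ℝ) < N := by exact_mod_cast NeZero.pos N
  have hK : 1 < expansion M := by linarith [two_le_expansion M]
  have hlogK : 0 < Real.log (expansion M) := Real.log_pos hK
  have hlogN : 2 * Real.log (expansion M) ≤ Real.log N := by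
    simpa only [Real.log_pow, Nat.cast_ofNat] using Real.log_le_log (by positivity) hN
  set y := Real.log N / (2 * Real.log (expansion M)) with hy
  have hy1 : 1 ≤ y := (one_le_div (by positivity)).2 hlogN
  have hT : 0 < ⌊y⌋₊ := Nat.floor_pos.2 hy1
  have hTR : (1 : ℝ) ≤ ⌊y⌋₊ := by exact_mod_cast hT
  have hyT : y ≤ 2 * ⌊y⌋₊ := by linarith [Nat.lt_floor_add_one y]
  have horbit : ∀ t < ⌊y⌋₊, 2 * (expansion M ^ t * ‖n‖) < N := fun t ht => by
    have hpow : expansion M ^ t ≤ √N := pow_le_sqrt_of_le_log_div hK hNR <|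
      (Nat.cast_le.2 ht.le).trans (Nat.floor_le (by linarith))
    have hprod : expansion M ^ t * (4 * ‖n‖) ≤ √N * √N := by gcongr
    rw [Real.mul_self_sqrt hNR.le] at hprod
    linarith
  refine (hφ.sum_norm_sq_le (upperRight_ne_zero hM) n hT
    (iterate_latticeMap_not_dvd hM hn horbit)).trans ?_
  rw [div_le_div_iff₀ (by linarith) (by linarith)]
  rw [hy, div_le_iff₀ (by positivity)] at hyT
  nlinarith

end Variance

section Torus

theorem norm_character (n : ℤ × ℤ) (x : Torus) : ‖character n x‖ = 1 := by
  simp [character, fourier_apply, Circle.norm_coe]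

theorem character_zero (x : Torus) : character 0 x = 1 := by
  simp [character]

instance : IsProbabilityMeasure (volume : Measure UnitAddCircle) :=
  ⟨UnitAddCircle.measure_univ⟩

instance : IsProbabilityMeasure (volume : Measure Torus) :=
  inferInstanceAs (IsProbabilityMeasure ((volume : Measure UnitAddCircle).prod volume))

instance : (volume : Measure Torus).IsAddLeftInvariant :=
  inferInstanceAs ((volume : Measure UnitAddCircle).prod volume).IsAddLeftInvariant

theorem volume_disc (x : Torus) (r : ℝ) :
    volume.real (disc x r) = volume.real (disc (0 : Torus) r) := by
  have hpreimage : disc x r = (fun y => y + -x) ⁻¹' disc 0 r := by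
    ext y
    simp [disc, sub_eq_add_neg]
  rw [hpreimage, measureReal_def, measureReal_def, measure_preimage_add_right]

/-- The lattice points of sup norm at most `d`. -/
def box (d : ℕ) : Finset (ℤ × ℤ) := Finset.Icc (-d : ℤ) d ×ˢ Finset.Icc (-d : ℤ) d

theorem mem_box {d : ℕ} {n : ℤ × ℤ} : n ∈ box d ↔ |n.1| ≤ d ∧ |n.2| ≤ d := by
  simp [box, abs_le]

theorem norm_le_of_mem_box {d : ℕ} {n : ℤ × ℤ} (hn : n ∈ box d) : ‖n‖ ≤ d := by
  obtain ⟨hfst, hsnd⟩ := mem_box.1 hn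
  refine max_le ?_ ?_ <;> rw [Int.norm_eq_abs]
  · exact_mod_cast hfst
  · exact_mod_cast hsnd

theorem card_box (d : ℕ) : (box d).card = (2 * d + 1) ^ 2 := by
  rw [box, Finset.card_product, Int.card_Icc, sq]
  congr 1 <;> omega

theorem mem_box_floor_of_sqrt_lt {D : ℝ} {n : ℤ × ℤ}
    (hn : √((n.1 : ℝ) ^ 2 + (n.2 : ℝ) ^ 2) < D) : n ∈ box ⌊D⌋₊ := by
  have hcoord {a : ℤ} (ha : (a : ℝ) ^ 2 ≤ (n.1 : ℝ) ^ 2 + (n.2 : ℝ) ^ 2) : |a| ≤ ⌊D⌋₊ := by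
    rw [Int.abs_eq_natAbs]
    refine Int.ofNat_le.2 (Nat.le_floor ?_)
    rw [Nat.cast_natAbs, Int.cast_abs]
    exact (Real.abs_le_sqrt ha).trans hn.le
  exact mem_box.2 ⟨hcoord (le_add_of_nonneg_right (sq_nonneg _)),
    hcoord (le_add_of_nonneg_left (sq_nonneg _))⟩

end Torus

section Fluctuation

variable {N : ℕ} {κ : ℝ × ℝ}

/-- The total size of the matrix elements `⟨T̂_N(n)Ψ, Ψ⟩`, `0 < |n| ≤ d`, which measures how far the
state `Ψ` is from being equidistributed in phase space. -/
def fluctuation (d : ℕ) (Ψ : State N κ) : ℝ :=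
  ∑ n ∈ (box d).erase 0, ‖stateInner (translationN N κ n Ψ) Ψ‖

theorem fluctuation_nonneg (d : ℕ) (Ψ : State N κ) : 0 ≤ fluctuation d Ψ :=
  Finset.sum_nonneg fun _ _ => norm_nonneg _

variable [NeZero N]

theorem stateInner_weylOp_of_support_subset {a : TrigPoly} {s : Finset (ℤ × ℤ)}
    (hs : a.support ⊆ s) (Ψ : State N κ) :
    stateInner (weylOp N κ a Ψ) Ψ = ∑ n ∈ s, a n * stateInner (translationN N κ n Ψ) Ψ := by
  rw [weylOp, Finsupp.sum_of_support_subset _ hs _ (by simp), ← inner_eq_stateInner,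
    LinearMap.sum_apply, inner_sum]
  simp only [LinearMap.smul_apply, inner_smul_right, inner_eq_stateInner]

theorem norm_stateInner_weylOp_translate_sub_le {a : TrigPoly} {d : ℕ} {c : ℝ}
    (ha : a.support ⊆ box d) (hc : ∀ n, ‖a n‖ ≤ c) {Ψ : State N κ} (hΨ : stateInner Ψ Ψ = 1)
    (x : Torus) :
    ‖stateInner (weylOp N κ (a.translate x) Ψ) Ψ - a 0‖ ≤ c * fluctuation d Ψ := by
  have hsupport : (a.translate x).support ⊆ box d := Finsupp.support_onFinset_subset.trans ha
  have hzero : (0 : ℤ × ℤ) ∈ box d := mem_box.2 (by simp)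
  have hconst : a.translate x 0 * stateInner (translationN N κ 0 Ψ) Ψ = a 0 := by
    simp [TrigPoly.translate, character_zero, translationN_zero, hΨ]
  rw [stateInner_weylOp_of_support_subset hsupport, ← Finset.add_sum_erase _ _ hzero, hconst,
    add_sub_cancel_left, fluctuation, Finset.mul_sum]
  refine norm_sum_le_of_le _ fun n _ => ?_
  rw [TrigPoly.translate, Finsupp.onFinset_apply, norm_mul, norm_mul, norm_character, one_mul]
  gcongr
  exact hc n

theorem norm_stateInner_weylOp_translate_sub_volume_le {a : TrigPoly} {D r c ε : ℝ}
    (hcoeff : ∀ n, ‖a n‖ ≤ c * r ^ 2)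
    (hdegree : ∀ n : ℤ × ℤ, D ≤ √((n.1 : ℝ) ^ 2 + (n.2 : ℝ) ^ 2) → a n = 0)
    (hintegral : ‖a 0 - (volume.real (disc 0 r) : ℂ)‖ ≤ ε / 2 * r ^ 2) {Ψ : State N κ}
    (hΨ : stateInner Ψ Ψ = 1) (hfluct : c * fluctuation ⌊D⌋₊ Ψ ≤ ε / 2) (x : Torus) :
    ‖stateInner (weylOp N κ (a.translate x) Ψ) Ψ - (volume.real (disc x r) : ℂ)‖ ≤ ε * r ^ 2 := by
  have hsupport : a.support ⊆ box ⌊D⌋₊ := fun n hn =>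
    mem_box_floor_of_sqrt_lt (lt_of_not_ge fun h => Finsupp.mem_support_iff.1 hn (hdegree n h))
  rw [volume_disc]
  calc _ ≤ _ := norm_sub_le_norm_sub_add_norm_sub _ (a 0) _
    _ ≤ c * r ^ 2 * fluctuation ⌊D⌋₊ Ψ + ε / 2 * r ^ 2 :=
      add_le_add (norm_stateInner_weylOp_translate_sub_le hsupport hcoeff hΨ x) hintegral
    _ = c * fluctuation ⌊D⌋₊ Ψ * r ^ 2 + ε / 2 * r ^ 2 := by ring
    _ ≤ ε / 2 * r ^ 2 + ε / 2 * r ^ 2 := by gcongr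
    _ = ε * r ^ 2 := by ring

theorem IsEigenbasis.sum_sq_fluctuation_le {M : SL(2, ℤ)} {φ : Fin N → State N κ}
    (hφ : IsEigenbasis M φ) (hM : 2 < |(M : Matrix (Fin 2) (Fin 2) ℤ).trace|)
    (hN : expansion M ^ 2 ≤ N) {d : ℕ} (hd : 4 * d ≤ √(N : ℝ)) :
    ∑ j, fluctuation d (φ j) ^ 2 ≤
      (2 * d + 1) ^ 4 * (4 * Real.log (expansion M) * N / Real.log N) := by
  have hvar : ∀ n ∈ (box d).erase 0, ∑ j, ‖stateInner (translationN N κ n (φ j)) (φ j)‖ ^ 2 ≤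
      4 * Real.log (expansion M) * N / Real.log N := fun n hn => by
    obtain ⟨hn0, hnd⟩ := Finset.mem_erase.1 hn
    exact hφ.sum_norm_sq_le_div_log hM hN hn0 (by linarith [norm_le_of_mem_box hnd])
  have hcard : (((box d).erase 0).card : ℝ) ≤ (2 * d + 1) ^ 2 := by
    exact_mod_cast Finset.card_erase_le.trans (card_box d).le
  have hnonneg : 0 ≤ 4 * Real.log (expansion M) * N / Real.log N := by
    have := Real.log_natCast_nonneg N
    have := Real.log_nonneg (one_le_two.trans (two_le_expansion M))
    positivity
  calc ∑ j, fluctuation d (φ j) ^ 2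
      ≤ ∑ j, (((box d).erase 0).card : ℝ) * ∑ n ∈ (box d).erase 0,
          ‖stateInner (translationN N κ n (φ j)) (φ j)‖ ^ 2 :=
        Finset.sum_le_sum fun j _ => sq_sum_le_card_mul_sum_sq
    _ = (((box d).erase 0).card : ℝ) * ∑ n ∈ (box d).erase 0, ∑ j,
          ‖stateInner (translationN N κ n (φ j)) (φ j)‖ ^ 2 := by
        rw [← Finset.mul_sum, Finset.sum_comm]
    _ ≤ (((box d).erase 0).card : ℝ) * ∑ n ∈ (box d).erase 0,
          4 * Real.log (expansion M) * N / Real.log N := by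
        gcongr with n hn
        exact hvar n hn
    _ = (((box d).erase 0).card : ℝ) ^ 2 * (4 * Real.log (expansion M) * N / Real.log N) := by
        rw [Finset.sum_const, nsmul_eq_mul]
        ring
    _ ≤ ((2 * d + 1) ^ 2) ^ 2 * (4 * Real.log (expansion M) * N / Real.log N) := by gcongr
    _ = _ := by ring

end Fluctuation

section Density

theorem one_sub_sqrt_le_density {ι : Type*} [Fintype ι] [Nonempty ι] {F : ι → ℝ} {e : ℝ}
    (he : 0 < e) (hF : ∑ j, F j ^ 2 ≤ e * Fintype.card ι) :
    1 - √e ≤ ({j | F j ^ 2 ≤ √e} : Finset ι).card / Fintype.card ι := by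
  have hcard : (({j | F j ^ 2 ≤ √e} : Finset ι).card : ℝ) +
      ({j | ¬ F j ^ 2 ≤ √e} : Finset ι).card = Fintype.card ι := by
    rw [← Finset.card_univ]
    exact_mod_cast Finset.card_filter_add_card_filter_not (s := Finset.univ)
      fun j => F j ^ (2 : ℕ) ≤ √e
  have hmarkov : ({j | ¬ F j ^ 2 ≤ √e} : Finset ι).card * √e ≤ √e * Fintype.card ι * √e := by
    calc ({j | ¬ F j ^ 2 ≤ √e} : Finset ι).card * √e
        ≤ ∑ j with ¬ F j ^ 2 ≤ √e, F j ^ 2 := by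
          rw [← nsmul_eq_mul]
          exact Finset.card_nsmul_le_sum _ _ _ fun j hj => (not_le.1 (Finset.mem_filter.1 hj).2).le
      _ ≤ ∑ j, F j ^ 2 := Finset.sum_le_sum_of_subset_of_nonneg (Finset.filter_subset _ _)
          fun _ _ _ => sq_nonneg _
      _ ≤ e * Fintype.card ι := hF
      _ = √e * Fintype.card ι * √e := by rw [mul_right_comm, Real.mul_self_sqrt he.le]
  have hbad := le_of_mul_le_mul_right hmarkov (Real.sqrt_pos.2 he)
  rw [le_div_iff₀ (by exact_mod_cast Fintype.card_pos)]
  linarith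

theorem tendsto_density_one {F : (N : ℕ) → Fin N → ℝ} {e : ℕ → ℝ} (he : Tendsto e atTop (𝓝 0))
    (hpos : ∀ᶠ N in atTop, 0 < e N) (hF : ∀ᶠ N in atTop, ∑ j, F N j ^ 2 ≤ e N * N) :
    Tendsto (fun N => (({j | F N j ^ 2 ≤ √(e N)} : Finset (Fin N)).card : ℝ) / N) atTop (𝓝 1) := by
  have hlower : Tendsto (fun N => 1 - √(e N)) atTop (𝓝 1) := by
    simpa using he.sqrt.const_sub 1
  refine tendsto_of_tendsto_of_tendsto_of_le_of_le' hlower tendsto_const_nhds ?_ ?_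
  · filter_upwards [hF, hpos, eventually_gt_atTop 0] with N hN heN hN0
    have : Nonempty (Fin N) := ⟨⟨0, hN0⟩⟩
    simpa using one_sub_sqrt_le_density (F := F N) heN (by simpa using hN)
  · refine Eventually.of_forall fun N => div_le_one_of_le₀ ?_ (Nat.cast_nonneg _)
    exact_mod_cast (Finset.card_le_univ _).trans_eq (Fintype.card_fin N)

end Density

section Ergodicity

variable {D : ℕ → ℝ}

theorem eventually_four_mul_le_sqrt (hD1 : ∀ᶠ N in atTop, 1 ≤ D N)
    (hD : (fun N : ℕ => D N ^ 4) =o[atTop] fun N : ℕ => Real.log N) :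
    ∀ᶠ N : ℕ in atTop, 4 * D N ≤ √N := by
  have hlog : (fun N : ℕ => Real.log N) =o[atTop] fun N : ℕ => √(N : ℝ) := by
    simpa only [Function.comp_def, Real.sqrt_eq_rpow] using
      (isLittleO_log_rpow_atTop (r := 1 / 2) (by norm_num)).comp_tendsto tendsto_natCast_atTop_atTop
  filter_upwards [(hD.trans hlog).def (c := 1 / 4) (by norm_num), hD1] with N hN hDN
  rw [Real.norm_of_nonneg (by positivity), Real.norm_of_nonneg (by positivity)] at hN
  linarith [le_self_pow₀ hDN four_ne_zero]

theorem eventually_sum_sq_fluctuation_le {M : SL(2, ℤ)}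
    (hM : 2 < |(M : Matrix (Fin 2) (Fin 2) ℤ).trace|) (hD1 : ∀ᶠ N in atTop, 1 ≤ D N)
    (hD : (fun N : ℕ => D N ^ 4) =o[atTop] fun N : ℕ => Real.log N) {κ : ℕ → ℝ × ℝ}
    {φ : (N : ℕ) → Fin N → State N (κ N)} (hφ : ∀ N, 0 < N → IsEigenbasis M (φ N)) :
    ∀ᶠ N : ℕ in atTop, ∑ j, fluctuation ⌊D N⌋₊ (φ N j) ^ 2 ≤
      324 * Real.log (expansion M) * (D N ^ 4 / Real.log N) * N := by
  filter_upwards [hD1, eventually_four_mul_le_sqrt hD1 hD, eventually_gt_atTop 0,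
    tendsto_natCast_atTop_atTop.eventually_ge_atTop (expansion M ^ 2)] with N hDN hsqrt hN hNM
  have : NeZero N := .of_pos hN
  have hfloor : (⌊D N⌋₊ : ℝ) ≤ D N := Nat.floor_le (by linarith)
  have := Real.log_natCast_nonneg N
  have := Real.log_nonneg (one_le_two.trans (two_le_expansion M))
  calc _ ≤ _ := (hφ N hN).sum_sq_fluctuation_le hM hNM (by linarith)
    _ ≤ (3 * D N) ^ 4 * (4 * Real.log (expansion M) * N / Real.log N) := by
      gcongr
      linarith
    _ = _ := by ring

theorem IsMajorantMinorant.quantumErgodicityAtScale {M : SL(2, ℤ)}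
    (hM : 2 < |(M : Matrix (Fin 2) (Fin 2) ℤ).trace|) {r : ℕ → ℝ}
    (hD1 : ∀ᶠ N in atTop, 1 ≤ D N)
    (hD : (fun N : ℕ => D N ^ 4) =o[atTop] fun N : ℕ => Real.log N)
    {aPlus aMinus : ℕ → TrigPoly} (ha : IsMajorantMinorant r D aPlus aMinus) :
    QuantumErgodicityAtScale M r aPlus aMinus := by
  intro κ _ φ hφ
  obtain ⟨c, hc⟩ := ha.coeff
  set e : ℕ → ℝ := fun N => 324 * Real.log (expansion M) * (D N ^ 4 / Real.log N)
  have hlim : Tendsto e atTop (𝓝 0) := by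
    simpa only [mul_zero] using
      hD.tendsto_div_nhds_zero.const_mul (324 * Real.log (expansion M))
  have hpos : ∀ᶠ N in atTop, 0 < e N := by
    filter_upwards [hD1, eventually_ge_atTop 2] with N hDN hN
    have : 0 < Real.log N := Real.log_pos (by exact_mod_cast hN)
    have : 0 < Real.log (expansion M) := Real.log_pos (by linarith [two_le_expansion M])
    positivity
  refine ⟨fun N => {j | fluctuation ⌊D N⌋₊ (φ N j) ^ 2 ≤ √(e N)},
    tendsto_density_one hlim hpos (eventually_sum_sq_fluctuation_le hM hD1 hD hφ), ?_⟩
  intro ε hε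
  have hsmall : ∀ᶠ N in atTop, |c| * √(√(e N)) ≤ ε / 2 := by
    have hlim' : Tendsto (fun N => |c| * √(√(e N))) atTop (𝓝 0) := by
      simpa using hlim.sqrt.sqrt.const_mul |c|
    exact hlim'.eventually_le_const (half_pos hε)
  filter_upwards [hsmall, hc, ha.degree, ha.integral_plus.def (half_pos hε),
    ha.integral_minus.def (half_pos hε), eventually_gt_atTop 0]
    with N hsmallN hcoeff hdegree hplus hminus hN j hj x
  have : NeZero N := .of_pos hN
  rw [Real.norm_of_nonneg (sq_nonneg _)] at hplus hminus
  have hnorm : stateInner (φ N j) (φ N j) = 1 := by rw [(hφ N hN).orthonormal, if_pos rfl]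
  have hfluct : c * fluctuation ⌊D N⌋₊ (φ N j) ≤ ε / 2 := by
    refine le_trans ?_ hsmallN
    gcongr
    · exact fluctuation_nonneg _ _
    · exact le_abs_self c
    · exact Real.le_sqrt_of_sq_le (Finset.mem_filter.1 hj).2
  exact ⟨norm_stateInner_weylOp_translate_sub_volume_le (fun n => (hcoeff n).1)
      (fun n hn => (hdegree n hn).1) hplus hnorm hfluct x,
    norm_stateInner_weylOp_translate_sub_volume_le (fun n => (hcoeff n).2)
      (fun n hn => (hdegree n hn).2) hminus hnorm hfluct x⟩

end Ergodicity

section TrigonometricPolynomials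

open scoped Pointwise ComplexConjugate

theorem continuous_character (n : ℤ × ℤ) : Continuous (character n) := by
  unfold character
  fun_prop

theorem character_add (m n : ℤ × ℤ) : character (m + n) = character m * character n := by
  ext x
  simp only [character, Prod.fst_add, Prod.snd_add, neg_add, fourier_add, Pi.mul_apply]
  ring

theorem character_neg (n : ℤ × ℤ) (x : Torus) : character (-n) x = conj (character n x) := by
  simp only [character, Prod.fst_neg, Prod.snd_neg, fourier_neg, map_mul]

theorem character_sub (n : ℤ × ℤ) (x y : Torus) :
    character n (x - y) = character n x * character n (-y) := by
  simp only [character, fourier_apply, Prod.fst_neg, Prod.snd_neg, sub_eq_add_neg,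
    Prod.fst_add, Prod.snd_add, smul_add, AddCircle.toCircle_add, Circle.coe_mul]
  ring

theorem integral_fourier (n : ℤ) :
    ∫ t : UnitAddCircle, (fourier n t : ℂ) = if n = 0 then 1 else 0 := by
  have h := congrFun (fourierCoeff_fourier (T := 1) n) 0
  simp only [fourierCoeff, AddCircle.integral_haarAddCircle, neg_zero, fourier_zero, one_smul,
    inv_one] at h
  rw [h, Pi.single_apply]
  exact if_congr eq_comm rfl rfl

theorem integral_character (n : ℤ × ℤ) : ∫ x, character n x = if n = 0 then 1 else 0 := by
  unfold character
  rw [Measure.volume_eq_prod, integral_prod_mul (fun t : UnitAddCircle => (fourier n.2 t : ℂ))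
    (fun t : UnitAddCircle => (fourier (-n.1) t : ℂ)), integral_fourier, integral_fourier]
  simp [Prod.ext_iff, ← ite_and]

theorem integrable_of_continuous {X E : Type*} [TopologicalSpace X] [CompactSpace X]
    [MeasurableSpace X] [OpensMeasurableSpace X] {μ : Measure X} [IsFiniteMeasureOnCompacts μ]
    [NormedAddCommGroup E] [SecondCountableTopologyEither X E] {f : X → E} (hf : Continuous f) :
    Integrable f μ :=
  hf.integrable_of_hasCompactSupport (HasCompactSupport.of_compactSpace f)

theorem TrigPoly.apply_eq_integral (a : TrigPoly) (n : ℤ × ℤ) :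
    a n = ∫ x, a.eval x * character (-n) x := by
  have hexpand (x : Torus) : a.eval x * character (-n) x =
      ∑ m ∈ a.support, a m * character (m - n) x := by
    rw [TrigPoly.eval, Finsupp.sum, Finset.sum_mul]
    refine Finset.sum_congr rfl fun m _ => ?_
    rw [sub_eq_add_neg, character_add, Pi.mul_apply, mul_assoc]
  simp_rw [hexpand]
  rw [integral_finsetSum _ fun m _ =>
    integrable_of_continuous ((continuous_character _).const_mul _)]
  simp [integral_const_mul, integral_character, sub_eq_zero]

theorem TrigPoly.apply_zero_eq_integral (a : TrigPoly) : a 0 = ∫ x, a.eval x := by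
  simp [a.apply_eq_integral, character_zero]

theorem TrigPoly.norm_apply_le (a : TrigPoly) (n : ℤ × ℤ) : ‖a n‖ ≤ ∫ x, ‖a.eval x‖ := by
  rw [a.apply_eq_integral]
  refine (norm_integral_le_integral_norm _).trans_eq ?_
  simp only [norm_mul, norm_character, mul_one]

/-- The trigonometric polynomials with frequencies in `s`, as functions on the torus. -/
def trigSpace (s : Set (ℤ × ℤ)) : Submodule ℂ (Torus → ℂ) := Submodule.span ℂ (character '' s)

variable {s t : Set (ℤ × ℤ)} {f g : Torus → ℂ}

theorem character_mem_trigSpace {n : ℤ × ℤ} (hn : n ∈ s) : character n ∈ trigSpace s :=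
  Submodule.subset_span ⟨n, hn, rfl⟩

theorem trigSpace_mono (hst : s ⊆ t) : trigSpace s ≤ trigSpace t :=
  Submodule.span_mono (Set.image_mono hst)

theorem mul_mem_trigSpace (hf : f ∈ trigSpace s) (hg : g ∈ trigSpace t) :
    f * g ∈ trigSpace (s + t) := by
  have hmul := Submodule.mul_mem_mul hf hg
  rw [trigSpace, trigSpace, Submodule.span_mul_span] at hmul
  refine Submodule.span_mono ?_ hmul
  rintro _ ⟨_, ⟨m, hm, rfl⟩, _, ⟨n, hn, rfl⟩, rfl⟩
  exact ⟨m + n, Set.add_mem_add hm hn, character_add m n⟩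

theorem star_mem_trigSpace (hf : f ∈ trigSpace s) : star f ∈ trigSpace (-s) := by
  induction hf using Submodule.span_induction with
  | mem f hf =>
    obtain ⟨n, hn, rfl⟩ := hf
    have hstar : star (character n) = character (-n) := funext fun x => (character_neg n x).symm
    exact hstar ▸ character_mem_trigSpace (Set.neg_mem_neg.2 hn)
  | zero => simp
  | add f g _ _ hf hg => simpa only [star_add] using add_mem hf hg
  | smul c f _ hf => simpa only [star_smul] using Submodule.smul_mem _ (star c) hf

theorem norm_sq_mem_trigSpace (hf : f ∈ trigSpace s) :
    (fun x => ((‖f x‖ ^ 2 : ℝ) : ℂ)) ∈ trigSpace (s - s) := by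
  rw [sub_eq_add_neg]
  convert mul_mem_trigSpace hf (star_mem_trigSpace hf) using 2 with x
  simp [Complex.mul_conj']

theorem exists_eval_eq_of_mem_trigSpace (hf : f ∈ trigSpace s) :
    ∃ a : TrigPoly, ↑a.support ⊆ s ∧ ∀ x, a.eval x = f x := by
  obtain ⟨a, ha, rfl⟩ := (Finsupp.mem_span_image_iff_linearCombination ℂ).1 hf
  exact ⟨a, (Finsupp.mem_supported ℂ a).1 ha, fun x => by
    simp [TrigPoly.eval, Finsupp.linearCombination_apply, Finsupp.sum, Finset.sum_apply]⟩

theorem continuous_of_mem_trigSpace (hf : f ∈ trigSpace s) : Continuous f := by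
  induction hf using Submodule.span_induction with
  | mem f hf =>
    obtain ⟨n, -, rfl⟩ := hf
    exact continuous_character n
  | zero => exact continuous_const
  | add f g _ _ hf hg => exact hf.add hg
  | smul c f _ hf => exact hf.const_smul c

end TrigonometricPolynomials

section Convolution

/-- The convolution of a trigonometric polynomial with a finite measure. -/
def TrigPoly.conv (a : TrigPoly) (μ : Measure Torus) : TrigPoly :=
  Finsupp.onFinset a.support (fun n => a n * ∫ y, character n (-y) ∂μ) fun _ hn =>
    Finsupp.mem_support_iff.2 (left_ne_zero_of_mul hn)

variable (a : TrigPoly) (μ : Measure Torus)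

theorem TrigPoly.support_conv_subset : (a.conv μ).support ⊆ a.support :=
  Finsupp.support_onFinset_subset

theorem TrigPoly.conv_apply_zero : a.conv μ 0 = a 0 * μ.real Set.univ := by
  simp [TrigPoly.conv, character_zero]

variable [IsFiniteMeasure μ]

theorem TrigPoly.norm_conv_apply_le (n : ℤ × ℤ) : ‖a.conv μ n‖ ≤ ‖a n‖ * μ.real Set.univ := by
  rw [TrigPoly.conv, Finsupp.onFinset_apply, norm_mul]
  gcongr
  simpa using norm_integral_le_of_norm_le_const (μ := μ)
    (Eventually.of_forall fun y => (norm_character n (-y)).le)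

theorem TrigPoly.eval_conv (x : Torus) : (a.conv μ).eval x = ∫ y, a.eval (x - y) ∂μ := by
  have hint (n : ℤ × ℤ) : Integrable (fun y => a n * character n (x - y)) μ :=
    integrable_of_continuous
      (((continuous_character n).comp (continuous_const.sub continuous_id)).const_mul _)
  rw [TrigPoly.eval, Finsupp.sum_of_support_subset _ (a.support_conv_subset μ) _ (by simp)]
  simp only [TrigPoly.eval, Finsupp.sum]
  rw [integral_finsetSum _ fun n _ => hint n]
  refine Finset.sum_congr rfl fun n _ => ?_
  simp only [character_sub, integral_const_mul, TrigPoly.conv, Finsupp.onFinset_apply]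
  ring

end Convolution

section SineKernel

open scoped ComplexConjugate

theorem integral_norm_sq_sum_fourier {ι : Type*} (s : Finset ι) {e : ι → ℤ}
    (he : Function.Injective e) (c : ι → ℝ) :
    ∫ t : UnitAddCircle, ‖∑ j ∈ s, (c j : ℂ) * fourier (e j) t‖ ^ 2 = ∑ j ∈ s, c j ^ 2 := by
  classical
  have hexpand (t : UnitAddCircle) : ((‖∑ j ∈ s, (c j : ℂ) * fourier (e j) t‖ ^ 2 : ℝ) : ℂ) =
      ∑ i ∈ s, ∑ j ∈ s, (c i * c j : ℂ) * fourier (e i - e j) t := by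
    rw [Complex.ofReal_pow, ← Complex.mul_conj', map_sum, Finset.sum_mul_sum]
    refine Finset.sum_congr rfl fun i _ => Finset.sum_congr rfl fun j _ => ?_
    rw [map_mul, Complex.conj_ofReal, sub_eq_add_neg, fourier_add, fourier_neg]
    ring
  have hint (i j : ι) :
      Integrable fun t : UnitAddCircle => (c i * c j : ℂ) * fourier (e i - e j) t :=
    integrable_of_continuous (by fun_prop)
  apply Complex.ofReal_injective
  rw [← integral_complex_ofReal]
  simp_rw [hexpand]
  rw [integral_finsetSum _ fun i _ => integrable_finsetSum _ fun j _ => hint i j]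
  simp_rw [integral_finsetSum _ fun j _ => hint _ j, integral_const_mul, integral_fourier,
    sub_eq_zero, he.eq_iff]
  simp [sq]

theorem sum_sq_sin_succ_sub_sin (θ : ℝ) (n : ℕ) :
    ∑ j ∈ Finset.range n, (Real.sin ((j + 1) * θ) - Real.sin (j * θ)) ^ 2 =
      2 * (1 - Real.cos θ) * ∑ j ∈ Finset.range n, Real.sin (j * θ) ^ 2 +
        Real.sin (n * θ) * (Real.sin (n * θ) - Real.sin ((n - 1) * θ)) := by
  induction n with
  | zero => simp
  | succ n ih =>
    rw [Finset.sum_range_succ, ih, Finset.sum_range_succ]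
    have hrec : Real.sin ((n + 1) * θ) + Real.sin ((n - 1) * θ) =
        2 * Real.cos θ * Real.sin (n * θ) := by
      rw [add_mul, sub_mul, one_mul, Real.sin_add, Real.sin_sub]
      ring
    push_cast
    rw [add_sub_cancel_right]
    linear_combination -Real.sin (n * θ) * hrec

theorem one_sub_mul_sum_pow {R : Type*} [CommRing R] (c : ℕ → R) {n : ℕ} (h0 : c 0 = 0)
    (hn : c n = 0) (z : R) :
    (1 - z) * ∑ j ∈ Finset.range n, c j * z ^ j =
      ∑ j ∈ Finset.range n, (c (j + 1) - c j) * z ^ (j + 1) := by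
  have htelescope := Finset.sum_range_sub (fun j => c j * z ^ j) n
  rw [h0, hn, zero_mul, zero_mul, sub_zero, Finset.sum_sub_distrib] at htelescope
  simp only [sub_mul, Finset.sum_sub_distrib, one_mul, pow_succ', Finset.mul_sum] at htelescope ⊢
  simp only [mul_left_comm z] at htelescope ⊢
  linear_combination -htelescope

theorem norm_le_norm_one_sub_fourier (t : UnitAddCircle) :
    4 * ‖t‖ ≤ ‖1 - (fourier 1 t : ℂ)‖ := by
  obtain ⟨x, rfl⟩ := QuotientAddGroup.mk_surjective t
  set y : ℝ := x - round x with hy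
  have hxy : (QuotientAddGroup.mk x : UnitAddCircle) = (y : UnitAddCircle) := by
    rw [hy, AddCircle.coe_sub, eq_comm, sub_eq_self, AddCircle.coe_eq_zero_iff]
    exact ⟨round x, by simp⟩
  have hyabs : |y| ≤ 1 / 2 := abs_sub_round x
  have hnorm : ‖(y : UnitAddCircle)‖ = |y| :=
    (AddCircle.norm_coe_eq_abs_iff 1 one_ne_zero).2 (by rwa [abs_one])
  have hexp : (fourier 1 (y : UnitAddCircle) : ℂ) =
      Complex.exp (Complex.I * ((2 * Real.pi * y : ℝ) : ℂ)) := by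
    rw [fourier_coe_apply]
    push_cast
    ring_nf
  have hsin := Real.mul_abs_le_abs_sin (x := Real.pi * y) (by
    rw [abs_mul, abs_of_pos Real.pi_pos]
    nlinarith [Real.pi_pos])
  rw [abs_mul, abs_of_pos Real.pi_pos, ← mul_assoc, div_mul_cancel₀ _ Real.pi_ne_zero] at hsin
  rw [hxy, hnorm, hexp, norm_sub_rev, Complex.norm_exp_I_mul_ofReal_sub_one, norm_mul,
    Real.norm_eq_abs, Real.norm_eq_abs, mul_assoc, mul_div_cancel_left₀ _ two_ne_zero, abs_two]
  linarith

/-- The trigonometric polynomial `q(t) = ∑_{j < n} sin(πj/n) e^{2πijt}`. Its coefficients are the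
lowest Dirichlet eigenvector of the second difference operator on `{1, …, n - 1}`, so it minimizes
`∫ |1 - e^{2πit}|² |q(t)|² dt / ∫ |q(t)|² dt` among the polynomials with these frequencies. -/
def sineWave (n : ℕ) (t : UnitAddCircle) : ℂ :=
  ∑ j ∈ Finset.range n, (Real.sin (j * (Real.pi / n)) : ℂ) * fourier j t

/-- The squared `L²` norm of `sineWave n`. -/
def sineMass (n : ℕ) : ℝ := ∑ j ∈ Finset.range n, Real.sin (j * (Real.pi / n)) ^ 2

variable {n : ℕ}

theorem sineMass_pos (hn : 2 ≤ n) : 0 < sineMass n := by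
  have hn0 : (2 : ℝ) ≤ n := by exact_mod_cast hn
  refine Finset.sum_pos' (fun _ _ => sq_nonneg _) ⟨1, Finset.mem_range.2 (by lia), ?_⟩
  refine pow_pos (Real.sin_pos_of_pos_of_lt_pi ?_ ?_) 2
  · have := Real.pi_pos
    positivity
  · rw [Nat.cast_one, one_mul]
    exact div_lt_self Real.pi_pos (by linarith)

theorem integral_norm_sq_sineWave (n : ℕ) : ∫ t, ‖sineWave n t‖ ^ 2 = sineMass n :=
  integral_norm_sq_sum_fourier _ Nat.cast_injective _

theorem one_sub_fourier_mul_sineWave (hn : n ≠ 0) (t : UnitAddCircle) :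
    (1 - fourier 1 t) * sineWave n t = ∑ j ∈ Finset.range n,
      ((Real.sin ((j + 1) * (Real.pi / n)) - Real.sin (j * (Real.pi / n)) : ℝ) : ℂ) *
        fourier (j + 1 : ℕ) t := by
  have hpow (j : ℕ) : (fourier (j : ℤ) t : ℂ) = fourier 1 t ^ j := by
    simp [fourier_apply, AddCircle.toCircle_nsmul]
  have hend : Real.sin (n * (Real.pi / n)) = 0 := by
    rw [mul_div_cancel₀ _ (Nat.cast_ne_zero.2 hn), Real.sin_pi]
  simp_rw [sineWave, hpow]
  rw [one_sub_mul_sum_pow _ (by simp) (by rw [hend, Complex.ofReal_zero])]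
  push_cast
  rfl

theorem integral_norm_sq_one_sub_fourier_mul_sineWave (hn : n ≠ 0) :
    ∫ t, ‖(1 - fourier 1 t) * sineWave n t‖ ^ 2 =
      2 * (1 - Real.cos (Real.pi / n)) * sineMass n := by
  simp_rw [one_sub_fourier_mul_sineWave hn]
  rw [integral_norm_sq_sum_fourier _ fun i j hij => by simpa using hij,
    sum_sq_sin_succ_sub_sin, mul_div_cancel₀ _ (Nat.cast_ne_zero.2 hn), Real.sin_pi, zero_mul,
    add_zero, sineMass]

end SineKernel

section ConcentratedKernel

open scoped Pointwise

/-- The trigonometric polynomials `∑_{0 ≤ j ≤ n} c_j e^{2πijt}` on the circle. -/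
def analyticSpace (n : ℕ) : Submodule ℂ (UnitAddCircle → ℂ) :=
  Submodule.span ℂ ((fun j : ℕ => ⇑(fourier (T := 1) j)) '' Set.Iic n)

variable {n : ℕ}

theorem sum_fourier_mem_analyticSpace {s : Finset ℕ} {e : ℕ → ℕ} (he : ∀ j ∈ s, e j ≤ n)
    (c : ℕ → ℂ) : (fun t => ∑ j ∈ s, c j * fourier (e j) t) ∈ analyticSpace n := by
  have hsum : (fun t : UnitAddCircle => ∑ j ∈ s, c j * fourier (e j) t) =
      ∑ j ∈ s, c j • ⇑(fourier (T := 1) (e j)) := by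
    ext t
    simp [Finset.sum_apply]
  rw [hsum]
  exact Submodule.sum_mem _ fun j hj => Submodule.smul_mem _ _
    (Submodule.subset_span ⟨e j, he j hj, rfl⟩)

theorem comp_fst_mem_trigSpace {p : UnitAddCircle → ℂ} (hp : p ∈ analyticSpace n) :
    p ∘ Prod.fst ∈ trigSpace (Set.Icc 0 (0, (n : ℤ))) := by
  induction hp using Submodule.span_induction with
  | mem p hp =>
    obtain ⟨j, hj, rfl⟩ := hp
    have hchar : ⇑(fourier (T := 1) j) ∘ Prod.fst = character (0, (j : ℤ)) := by
      ext x
      simp [character]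
    rw [hchar]
    exact character_mem_trigSpace ⟨⟨le_rfl, Int.natCast_nonneg j⟩, le_rfl, Int.ofNat_le.2 hj⟩
  | zero => exact zero_mem _
  | add p q _ _ hp hq => exact add_mem hp hq
  | smul c p _ hp => exact Submodule.smul_mem _ c hp

theorem comp_snd_mem_trigSpace {p : UnitAddCircle → ℂ} (hp : p ∈ analyticSpace n) :
    p ∘ Prod.snd ∈ trigSpace (Set.Icc (-(n : ℤ), 0) 0) := by
  induction hp using Submodule.span_induction with
  | mem p hp =>
    obtain ⟨j, hj, rfl⟩ := hp
    have hchar : ⇑(fourier (T := 1) j) ∘ Prod.snd = character (-(j : ℤ), 0) := by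
      ext x
      simp [character]
    rw [hchar]
    exact character_mem_trigSpace ⟨⟨neg_le_neg (Int.ofNat_le.2 hj), le_rfl⟩,
      neg_nonpos.2 (Int.natCast_nonneg j), le_rfl⟩
  | zero => exact zero_mem _
  | add p q _ _ hp hq => exact add_mem hp hq
  | smul c p _ hp => exact Submodule.smul_mem _ c hp

theorem norm_sq_mul_norm_sq_mem_trigSpace {p q : UnitAddCircle → ℂ} (hp : p ∈ analyticSpace n)
    (hq : q ∈ analyticSpace n) :
    (fun x : Torus => ((‖p x.1‖ ^ 2 * ‖q x.2‖ ^ 2 : ℝ) : ℂ)) ∈ trigSpace (box n) := by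
  have hbox : Set.Icc 0 (0, (n : ℤ)) + Set.Icc (-(n : ℤ), 0) 0 -
      (Set.Icc 0 (0, (n : ℤ)) + Set.Icc (-(n : ℤ), 0) 0) ⊆ (box n : Set (ℤ × ℤ)) := by
    rintro _ ⟨_, ⟨a, ha, b, hb, rfl⟩, _, ⟨a', ha', b', hb', rfl⟩, rfl⟩
    simp only [Set.mem_Icc, Prod.le_def, Prod.fst_zero, Prod.snd_zero] at ha hb ha' hb'
    refine mem_box.2 ?_
    simp only [abs_le, Prod.fst_sub, Prod.fst_add, Prod.snd_sub, Prod.snd_add]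
    lia
  refine trigSpace_mono hbox ?_
  simpa only [Pi.mul_apply, Function.comp_apply, norm_mul, mul_pow] using norm_sq_mem_trigSpace
    (mul_mem_trigSpace (comp_fst_mem_trigSpace hp) (comp_snd_mem_trigSpace hq))

theorem sineWave_mem_analyticSpace (n : ℕ) : sineWave n ∈ analyticSpace n :=
  sum_fourier_mem_analyticSpace (fun _ hj => (Finset.mem_range.1 hj).le) _

theorem one_sub_fourier_mul_sineWave_mem_analyticSpace (hn : n ≠ 0) :
    (fun t => (1 - fourier 1 t) * sineWave n t) ∈ analyticSpace n := by
  simp_rw [one_sub_fourier_mul_sineWave hn]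
  exact sum_fourier_mem_analyticSpace (fun _ hj => Finset.mem_range.1 hj) _

/-- A nonnegative trigonometric polynomial `k` of degree at most `d` on the torus, together with a
trigonometric polynomial `g ≤ k` that is positive only within distance `ε` of `0`. If the integral
of `g` is close to that of `k`, then `k` is concentrated near `0`. -/
structure IsConcentrated (d : ℕ) (ε : ℝ) (k g : Torus → ℝ) : Prop where
  kernel_mem : (fun x => (k x : ℂ)) ∈ trigSpace (box d)
  minorant_mem : (fun x => (g x : ℂ)) ∈ trigSpace (box d)
  nonneg : ∀ x, 0 ≤ k x
  minorant_le : ∀ x, g x ≤ k x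
  minorant_nonpos : ∀ x ∉ disc 0 ε, g x ≤ 0

/-- The product kernel `|q(x₁)|²|q(x₂)|²` of mass one, where `q` is a multiple of `sineWave n`. -/
def sineKernel (n : ℕ) (x : Torus) : ℝ :=
  ‖sineWave n x.1‖ ^ 2 * ‖sineWave n x.2‖ ^ 2 / sineMass n ^ 2

/-- The product of `sineKernel n` with the trigonometric polynomial
`1 - (|1 - e^{2πix₁}|² + |1 - e^{2πix₂}|²) / (16ε²)`, which is at most `1 - |x|² / ε²`. -/
def sineMinorant (n : ℕ) (ε : ℝ) (x : Torus) : ℝ :=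
  sineKernel n x *
    (1 - (‖1 - (fourier 1 x.1 : ℂ)‖ ^ 2 + ‖1 - (fourier 1 x.2 : ℂ)‖ ^ 2) / (16 * ε ^ 2))

theorem sineKernel_nonneg (n : ℕ) (x : Torus) : 0 ≤ sineKernel n x := by
  unfold sineKernel
  positivity

theorem sineMinorant_eq (n : ℕ) (ε : ℝ) (x : Torus) :
    sineMinorant n ε x = (sineMass n ^ 2)⁻¹ * (‖sineWave n x.1‖ ^ 2 * ‖sineWave n x.2‖ ^ 2) -
      (sineMass n ^ 2 * (16 * ε ^ 2))⁻¹ *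
        (‖(1 - fourier 1 x.1) * sineWave n x.1‖ ^ 2 * ‖sineWave n x.2‖ ^ 2) -
      (sineMass n ^ 2 * (16 * ε ^ 2))⁻¹ *
        (‖sineWave n x.1‖ ^ 2 * ‖(1 - fourier 1 x.2) * sineWave n x.2‖ ^ 2) := by
  rw [sineMinorant, sineKernel, mul_inv, norm_mul, norm_mul]
  ring

theorem isConcentrated_sineKernel (hn : n ≠ 0) {ε : ℝ} (hε : 0 < ε) :
    IsConcentrated n ε (sineKernel n) (sineMinorant n ε) where
  kernel_mem := by
    have hmem := norm_sq_mul_norm_sq_mem_trigSpace (sineWave_mem_analyticSpace n)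
      (sineWave_mem_analyticSpace n)
    convert Submodule.smul_mem _ ((sineMass n ^ 2)⁻¹ : ℂ) hmem using 2 with x
    simp [sineKernel, div_eq_inv_mul]
  minorant_mem := by
    have hwave := sineWave_mem_analyticSpace n
    have hwave' := one_sub_fourier_mul_sineWave_mem_analyticSpace hn
    have hmem := sub_mem (sub_mem
      (Submodule.smul_mem _ ((sineMass n ^ 2)⁻¹ : ℂ)
        (norm_sq_mul_norm_sq_mem_trigSpace hwave hwave))
      (Submodule.smul_mem _ ((sineMass n ^ 2 * (16 * ε ^ 2))⁻¹ : ℂ)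
        (norm_sq_mul_norm_sq_mem_trigSpace hwave' hwave)))
      (Submodule.smul_mem _ ((sineMass n ^ 2 * (16 * ε ^ 2))⁻¹ : ℂ)
        (norm_sq_mul_norm_sq_mem_trigSpace hwave hwave'))
    convert hmem using 2 with x
    simp [sineMinorant_eq]
  nonneg := sineKernel_nonneg n
  minorant_le x := mul_le_of_le_one_right (sineKernel_nonneg n x)
    (sub_le_self _ (by positivity))
  minorant_nonpos x hx := by
    have hdist : ε ^ 2 ≤ ‖x.1‖ ^ 2 + ‖x.2‖ ^ 2 := by
      rw [← Real.le_sqrt' hε]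
      simpa [disc] using hx
    have hchord (t : UnitAddCircle) : 16 * ‖t‖ ^ 2 ≤ ‖1 - (fourier 1 t : ℂ)‖ ^ 2 := by
      nlinarith [norm_le_norm_one_sub_fourier t, norm_nonneg t]
    refine mul_nonpos_of_nonneg_of_nonpos (sineKernel_nonneg n x) (sub_nonpos.2 ?_)
    rw [one_le_div (by positivity)]
    linarith [hchord x.1, hchord x.2]

theorem integral_sineKernel (hn : 2 ≤ n) : ∫ x, sineKernel n x = 1 := by
  unfold sineKernel
  have hmass := (sineMass_pos hn).ne'
  rw [integral_div, Measure.volume_eq_prod, integral_prod_mul (fun t => ‖sineWave n t‖ ^ 2)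
    (fun t => ‖sineWave n t‖ ^ 2), integral_norm_sq_sineWave, ← sq, div_self (pow_ne_zero 2 hmass)]

theorem integral_sineMinorant (hn : 2 ≤ n) (ε : ℝ) :
    ∫ x, sineMinorant n ε x = 1 - (1 - Real.cos (Real.pi / n)) / (4 * ε ^ 2) := by
  have hmass := (sineMass_pos hn).ne'
  have hwave : Continuous (sineWave n) := by
    unfold sineWave
    fun_prop
  have hint {p q : UnitAddCircle → ℂ} (hp : Continuous p) (hq : Continuous q) :
      Integrable fun x : Torus => ‖p x.1‖ ^ 2 * ‖q x.2‖ ^ 2 :=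
    integrable_of_continuous (by fun_prop)
  have hprod (p q : UnitAddCircle → ℂ) : ∫ x : Torus, ‖p x.1‖ ^ 2 * ‖q x.2‖ ^ 2 =
      (∫ t, ‖p t‖ ^ 2) * ∫ t, ‖q t‖ ^ 2 :=
    integral_prod_mul (fun t => ‖p t‖ ^ 2) (fun t => ‖q t‖ ^ 2)
  have hwave' : Continuous fun t => (1 - fourier 1 t) * sineWave n t := by fun_prop
  simp_rw [sineMinorant_eq]
  rw [integral_sub (((hint hwave hwave).const_mul _).sub' ((hint hwave' hwave).const_mul _))
      ((hint hwave hwave').const_mul _),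
    integral_sub ((hint hwave hwave).const_mul _) ((hint hwave' hwave).const_mul _),
    integral_const_mul, integral_const_mul, integral_const_mul,
    hprod, hprod (fun t => (1 - fourier 1 t) * sineWave n t),
    hprod _ fun t => (1 - fourier 1 t) * sineWave n t, integral_norm_sq_sineWave,
    integral_norm_sq_one_sub_fourier_mul_sineWave (by lia)]
  field_simp
  ring

end ConcentratedKernel

section DiscGeometry

variable {x y : Torus} {r s : ℝ}

theorem mem_disc_zero_iff_norm_toLp : x ∈ disc 0 r ↔ ‖WithLp.toLp 2 x‖ < r := by
  simp [disc, WithLp.prod_norm_eq_of_L2]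

theorem add_mem_disc (hx : x ∈ disc 0 r) (hy : y ∈ disc 0 s) : x + y ∈ disc 0 (r + s) := by
  rw [mem_disc_zero_iff_norm_toLp] at *
  rw [WithLp.toLp_add]
  exact (norm_add_le _ _).trans_lt (add_lt_add hx hy)

theorem sub_mem_disc (hx : x ∈ disc 0 r) (hy : y ∈ disc 0 s) : x - y ∈ disc 0 (r + s) := by
  rw [mem_disc_zero_iff_norm_toLp] at *
  rw [WithLp.toLp_sub]
  exact (norm_sub_le _ _).trans_lt (add_lt_add hx hy)

theorem disc_mono (h : r ≤ s) : disc x r ⊆ disc x s := fun _ hy => lt_of_lt_of_le hy h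

theorem measurableSet_disc (x : Torus) (r : ℝ) : MeasurableSet (disc x r) :=
  (isOpen_lt (by fun_prop) continuous_const).measurableSet

/-- The annulus between the discs lifts, inside the square fundamental domain, to a part of the
Euclidean annulus. -/
theorem volume_disc_sdiff_le (r s : ℝ) :
    volume (disc 0 s \ disc 0 r) ≤ volume (Metric.ball (0 : ℂ) s \ Metric.ball 0 r) := by
  set I : Set ℝ := Set.Ioc (-(1 / 2)) (-(1 / 2) + 1)
  have hproj := (UnitAddCircle.measurePreserving_mk (-(1 / 2))).prod
    (UnitAddCircle.measurePreserving_mk (-(1 / 2)))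
  have hmeas := (measurableSet_disc 0 s).diff (measurableSet_disc 0 r)
  have hball := Metric.isOpen_ball.measurableSet.diff
    (Metric.isOpen_ball (x := (0 : ℂ)) (ε := r)).measurableSet (s₁ := Metric.ball (0 : ℂ) s)
  have hnorm (t : ℝ) (ht : t ∈ I) : ‖(t : UnitAddCircle)‖ = |t| :=
    (AddCircle.norm_coe_eq_abs_iff 1 one_ne_zero).2 <| by
      rw [abs_one, abs_le]
      exact ⟨ht.1.le, by linarith [ht.2]⟩
  have hpre := hproj.measure_preimage hmeas.nullMeasurableSet
  rw [Measure.prod_restrict, Measure.restrict_apply (hproj.measurable hmeas)] at hpre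
  rw [← (Complex.volume_preserving_equiv_real_prod.symm _).measure_preimage
    hball.nullMeasurableSet]
  refine hpre.symm.le.trans (measure_mono ?_)
  rintro ⟨t, u⟩ ⟨htu, ht, hu⟩
  simpa [disc, Complex.norm_eq_sqrt_sq_add_sq, hnorm t ht, hnorm u hu] using htu

theorem volume_disc_le_add (hr : 0 ≤ r) (hrs : r ≤ s) :
    volume.real (disc 0 s) ≤ volume.real (disc 0 r) + Real.pi * (s ^ 2 - r ^ 2) := by
  have hball {t : ℝ} (ht : 0 ≤ t) : volume.real (Metric.ball (0 : ℂ) t) = Real.pi * t ^ 2 := by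
    simp [measureReal_def, Complex.volume_ball, ENNReal.toReal_ofReal ht, mul_comm]
  have hle := ENNReal.toReal_mono (measure_ne_top_of_subset Set.sdiff_subset
    measure_ball_lt_top.ne) (volume_disc_sdiff_le r s)
  rw [← measureReal_def, ← measureReal_def,
    measureReal_sdiff (disc_mono hrs) (measurableSet_disc 0 r),
    measureReal_sdiff (Metric.ball_subset_ball hrs) Metric.isOpen_ball.measurableSet
      measure_ball_lt_top.ne, hball hr, hball (hr.trans hrs)] at hle
  linarith

theorem volume_disc_le (hr : 0 ≤ r) : volume.real (disc 0 r) ≤ Real.pi * r ^ 2 := by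
  have hempty : disc 0 0 = ∅ := Set.eq_empty_of_forall_notMem fun y hy =>
    (Real.sqrt_nonneg _).not_gt hy
  simpa [hempty] using volume_disc_le_add le_rfl hr

instance : (volume : Measure Torus).IsNegInvariant :=
  ⟨((Measure.measurePreserving_neg (volume : Measure UnitAddCircle)).prod
    (Measure.measurePreserving_neg (volume : Measure UnitAddCircle))).map_eq⟩

end DiscGeometry

section DiscApproximation

variable {d : ℕ} {r ε η : ℝ} {k g f : Torus → ℝ}

theorem continuous_of_ofReal_mem_trigSpace {s : Set (ℤ × ℤ)}
    (hf : (fun x => (f x : ℂ)) ∈ trigSpace s) : Continuous f :=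
  Complex.continuous_re.comp (continuous_of_mem_trigSpace hf)

theorem exists_eval_eq_setIntegral {s : Set (ℤ × ℤ)} (hf : (fun x => (f x : ℂ)) ∈ trigSpace s)
    (S : Set Torus) : ∃ a : TrigPoly, ↑a.support ⊆ s ∧
      (∀ x, a.eval x = ((∫ y in S, f (x - y) : ℝ) : ℂ)) ∧
      a 0 = (((∫ x, f x) * volume.real S : ℝ) : ℂ) ∧
      ∀ n, ‖a n‖ ≤ (∫ x, |f x|) * volume.real S := by
  obtain ⟨a, hsupp, heval⟩ := exists_eval_eq_of_mem_trigSpace hf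
  refine ⟨a.conv (volume.restrict S),
    (Finset.coe_subset.2 (a.support_conv_subset _)).trans hsupp, fun x => ?_, ?_, fun n => ?_⟩
  · simp only [TrigPoly.eval_conv, heval, integral_complex_ofReal]
  · rw [TrigPoly.conv_apply_zero, a.apply_zero_eq_integral]
    simp only [heval, integral_complex_ofReal, measureReal_restrict_apply_univ,
      Complex.ofReal_mul]
  · refine (a.norm_conv_apply_le _ n).trans ?_
    rw [measureReal_restrict_apply_univ]
    gcongr
    simpa only [heval, Complex.norm_real, Real.norm_eq_abs] using a.norm_apply_le n

/-- `a` is a real trigonometric polynomial of degree at most `d`, with coefficients bounded by `C`,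
whose integral is within `e` of the area of the disc of radius `r`. -/
structure TrigPoly.ApproximatesDisc (a : TrigPoly) (d : ℕ) (r C e : ℝ) : Prop where
  support_subset : a.support ⊆ box d
  im_eval : ∀ x, (a.eval x).im = 0
  norm_apply_le : ∀ n, ‖a n‖ ≤ C
  norm_apply_zero_sub_le : ‖a 0 - (volume.real (disc 0 r) : ℂ)‖ ≤ e

namespace IsConcentrated

theorem smul (h : IsConcentrated d ε k g) {c : ℝ} (hc : 0 ≤ c) :
    IsConcentrated d ε (fun x => c * k x) fun x => c * g x where
  kernel_mem := by simpa [Pi.smul_def] using Submodule.smul_mem _ (c : ℂ) h.kernel_mem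
  minorant_mem := by simpa [Pi.smul_def] using Submodule.smul_mem _ (c : ℂ) h.minorant_mem
  nonneg x := mul_nonneg hc (h.nonneg x)
  minorant_le x := mul_le_mul_of_nonneg_left (h.minorant_le x) hc
  minorant_nonpos x hx := mul_nonpos_of_nonneg_of_nonpos hc (h.minorant_nonpos x hx)

variable (h : IsConcentrated d ε k g)
include h

theorem integrable_kernel : Integrable k :=
  integrable_of_continuous (continuous_of_ofReal_mem_trigSpace h.kernel_mem)

theorem integrable_minorant : Integrable g :=
  integrable_of_continuous (continuous_of_ofReal_mem_trigSpace h.minorant_mem)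

theorem integral_minorant_le_integral_kernel : ∫ x, g x ≤ ∫ x, k x :=
  integral_mono h.integrable_minorant h.integrable_kernel h.minorant_le

theorem integral_abs_minorant_le : ∫ x, |g x| ≤ 2 * (∫ x, k x) - ∫ x, g x := by
  rw [← integral_const_mul, ← integral_sub (h.integrable_kernel.const_mul 2) h.integrable_minorant]
  refine integral_mono h.integrable_minorant.abs
    ((h.integrable_kernel.const_mul 2).sub h.integrable_minorant) fun x => abs_le.2 ⟨?_, ?_⟩
  · linarith [h.nonneg x]
  · linarith [h.minorant_le x]

theorem integral_minorant_le_setIntegral_kernel {x : Torus} (hx : x ∈ disc 0 r) :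
    ∫ y, g y ≤ ∫ y in disc 0 (r + ε), k (x - y) := by
  have hg := h.integrable_minorant.comp_sub_left x
  have hS := measurableSet_disc 0 (r + ε)
  rw [← integral_sub_left_eq_self g volume x, ← integral_add_compl hS hg]
  have hin : ∫ y in disc 0 (r + ε), g (x - y) ≤ ∫ y in disc 0 (r + ε), k (x - y) :=
    integral_mono hg.integrableOn (h.integrable_kernel.comp_sub_left x).integrableOn
      fun y => h.minorant_le (x - y)
  have hout : ∫ y in (disc 0 (r + ε))ᶜ, g (x - y) ≤ 0 := by
    refine setIntegral_nonpos hS.compl fun y hy => h.minorant_nonpos _ fun hxy => hy ?_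
    simpa using sub_mem_disc hx hxy
  linarith

theorem setIntegral_minorant_le_integral_kernel (S : Set Torus) (x : Torus) :
    ∫ y in S, g (x - y) ≤ ∫ y, k y := by
  have hk := h.integrable_kernel.comp_sub_left x
  calc ∫ y in S, g (x - y) ≤ ∫ y in S, k (x - y) :=
        integral_mono (h.integrable_minorant.comp_sub_left x).integrableOn hk.integrableOn
          fun y => h.minorant_le (x - y)
    _ ≤ ∫ y, k (x - y) := setIntegral_le_integral hk (Eventually.of_forall fun y => h.nonneg _)
    _ = ∫ y, k y := integral_sub_left_eq_self k volume x

theorem setIntegral_minorant_nonpos {x : Torus} (hx : x ∉ disc 0 r) :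
    ∫ y in disc 0 (r - ε), g (x - y) ≤ 0 := by
  refine setIntegral_nonpos (measurableSet_disc 0 _) fun y hy =>
    h.minorant_nonpos _ fun hxy => hx ?_
  simpa using add_mem_disc hy hxy

theorem exists_majorant (hε0 : 0 ≤ ε) (hε : ε ≤ r) (hη : η ≤ 1) (hg : ∫ x, g x = 1)
    (hk : ∫ x, k x ≤ 1 + η) : ∃ a : TrigPoly,
      a.ApproximatesDisc d r (8 * Real.pi * r ^ 2) (Real.pi * (3 * r * ε + 4 * η * r ^ 2)) ∧
      ∀ x, (disc 0 r).indicator (fun _ => (1 : ℝ)) x ≤ (a.eval x).re := by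
  obtain ⟨a, hsupp, heval, hzero, hcoeff⟩ :=
    exists_eval_eq_setIntegral h.kernel_mem (disc 0 (r + ε))
  have hk1 := hg.symm.trans_le h.integral_minorant_le_integral_kernel
  have hmono := measureReal_mono (μ := volume) (disc_mono (x := 0) (le_add_of_nonneg_right hε0))
  have hvol : volume.real (disc 0 (r + ε)) ≤ volume.real (disc 0 r) + Real.pi * (3 * r * ε) := by
    refine (volume_disc_le_add (hε0.trans hε) (le_add_of_nonneg_right hε0)).trans ?_
    gcongr
    nlinarith
  have hvol4 : volume.real (disc 0 (r + ε)) ≤ Real.pi * (4 * r ^ 2) := by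
    refine (volume_disc_le (by linarith)).trans ?_
    gcongr
    nlinarith
  refine ⟨a, ⟨Finset.coe_subset.1 hsupp, fun x => by rw [heval, Complex.ofReal_im],
    fun n => (hcoeff n).trans ?_, ?_⟩, fun x => ?_⟩
  · simp only [abs_of_nonneg (h.nonneg _)]
    calc (∫ x, k x) * volume.real (disc 0 (r + ε)) ≤ 2 * (Real.pi * (4 * r ^ 2)) := by
          gcongr
          linarith
      _ = 8 * Real.pi * r ^ 2 := by ring
  · rw [hzero, ← Complex.ofReal_sub, Complex.norm_real, Real.norm_eq_abs, abs_of_nonneg]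
    · nlinarith [mul_le_mul (sub_le_iff_le_add'.2 hk) hvol4 measureReal_nonneg (by linarith)]
    · nlinarith [measureReal_nonneg (μ := volume) (s := disc 0 (r + ε))]
  · rw [heval, Complex.ofReal_re]
    by_cases hx : x ∈ disc 0 r
    · rw [Set.indicator_of_mem hx]
      exact hg.symm.trans_le (h.integral_minorant_le_setIntegral_kernel hx)
    · rw [Set.indicator_of_notMem hx]
      exact integral_nonneg fun y => h.nonneg _

theorem exists_minorant (hε0 : 0 ≤ ε) (hε : ε ≤ r) (hη : η ≤ 1) (hk : ∫ x, k x = 1)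
    (hg : 1 - η ≤ ∫ x, g x) : ∃ a : TrigPoly,
      a.ApproximatesDisc d r (8 * Real.pi * r ^ 2) (Real.pi * (3 * r * ε + 4 * η * r ^ 2)) ∧
      ∀ x, (a.eval x).re ≤ (disc 0 r).indicator (fun _ => (1 : ℝ)) x := by
  obtain ⟨a, hsupp, heval, hzero, hcoeff⟩ :=
    exists_eval_eq_setIntegral h.minorant_mem (disc 0 (r - ε))
  have hg1 := h.integral_minorant_le_integral_kernel.trans_eq hk
  have hmono := measureReal_mono (μ := volume) (disc_mono (x := 0) (sub_le_self r hε0))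
  have hvol : volume.real (disc 0 r) ≤
      volume.real (disc 0 (r - ε)) + Real.pi * (2 * r * ε) := by
    refine (volume_disc_le_add (sub_nonneg.2 hε) (sub_le_self r hε0)).trans ?_
    gcongr
    nlinarith
  have hvol1 : volume.real (disc 0 (r - ε)) ≤ Real.pi * r ^ 2 :=
    hmono.trans (volume_disc_le (hε0.trans hε))
  have hη0 : 0 ≤ η := by linarith
  have hr : 0 ≤ r := hε0.trans hε
  refine ⟨a, ⟨Finset.coe_subset.1 hsupp, fun x => by rw [heval, Complex.ofReal_im],
    fun n => (hcoeff n).trans ?_, ?_⟩, fun x => ?_⟩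
  · calc (∫ x, |g x|) * volume.real (disc 0 (r - ε)) ≤ 8 * (Real.pi * r ^ 2) := by
          gcongr
          linarith [h.integral_abs_minorant_le]
      _ = 8 * Real.pi * r ^ 2 := by ring
  · rw [hzero, ← Complex.ofReal_sub, Complex.norm_real, Real.norm_eq_abs, abs_sub_comm,
      abs_of_nonneg]
    · have hloss := mul_le_mul (sub_le_comm.1 hg) hvol1 measureReal_nonneg hη0
      linarith [show 0 ≤ Real.pi * (r * ε) by positivity,
        show 0 ≤ Real.pi * (η * r ^ 2) by positivity]
    · nlinarith [measureReal_nonneg (μ := volume) (s := disc 0 (r - ε))]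
  · rw [heval, Complex.ofReal_re]
    by_cases hx : x ∈ disc 0 r
    · rw [Set.indicator_of_mem hx]
      exact (h.setIntegral_minorant_le_integral_kernel _ x).trans_eq hk
    · rw [Set.indicator_of_notMem hx]
      exact h.setIntegral_minorant_nonpos hx

end IsConcentrated

end DiscApproximation

section ExistenceOfMajorants

/-- A pair consisting of a majorant and a minorant of the indicator function of the disc of radius
`r`, both approximating it in the sense of `TrigPoly.ApproximatesDisc`. -/
structure IsDiscPair (d : ℕ) (r C e : ℝ) (a : TrigPoly × TrigPoly) : Prop where
  approximates_fst : a.1.ApproximatesDisc d r C e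
  approximates_snd : a.2.ApproximatesDisc d r C e
  majorant : ∀ x, (disc 0 r).indicator (fun _ => (1 : ℝ)) x ≤ (a.1.eval x).re
  minorant : ∀ x, (a.2.eval x).re ≤ (disc 0 r).indicator (fun _ => (1 : ℝ)) x

theorem exists_isDiscPair {n : ℕ} (hn : 2 ≤ n) {r ε η : ℝ} (hε0 : 0 < ε) (hε : ε ≤ r)
    (hη : (1 - Real.cos (Real.pi / n)) / (4 * ε ^ 2) ≤ η) (hη1 : η ≤ 1 / 2) :
    ∃ a, IsDiscPair n r (8 * Real.pi * r ^ 2) (Real.pi * (3 * r * ε + 8 * η * r ^ 2)) a := by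
  have hker := isConcentrated_sineKernel (n := n) (by lia) hε0
  have hk := integral_sineKernel hn
  have hg := integral_sineMinorant hn ε
  set m := ∫ x, sineMinorant n ε x
  have hη0 : 0 ≤ η := le_trans (div_nonneg (sub_nonneg.2 (Real.cos_le_one _)) (by positivity)) hη
  have hm_ge : 1 - η ≤ m := by linarith
  have hm : 0 < m := by linarith
  have hm_inv : m⁻¹ ≤ 1 + 2 * η := by
    rw [inv_le_iff_one_le_mul₀ hm]
    nlinarith
  obtain ⟨aPlus, happrox, hmaj⟩ := (hker.smul (inv_nonneg.2 hm.le)).exists_majorant (η := 2 * η)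
    hε0.le hε (by linarith) (by rw [integral_const_mul, inv_mul_cancel₀ hm.ne'])
    (by rwa [integral_const_mul, hk, mul_one])
  obtain ⟨aMinus, happrox', hmin⟩ := hker.exists_minorant (η := 2 * η) hε0.le hε
    (by linarith) hk (le_trans (by linarith) hm_ge)
  rw [← mul_assoc, show (4 : ℝ) * 2 = 8 by norm_num] at happrox happrox'
  exact ⟨(aPlus, aMinus), happrox, happrox', hmaj, hmin⟩

theorem exists_isDiscPair_floor {r D : ℝ} (hr : 0 < r) (hD : 4 ≤ D)
    (hrD : 4 * Real.pi ^ 2 ≤ r * D) :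
    ∃ a, IsDiscPair ⌊D / 2⌋₊ r (8 * Real.pi * r ^ 2)
      (Real.pi * (3 / √(r * D) + 16 * Real.pi ^ 2 / (r * D)) * r ^ 2) a := by
  have hq : 0 < r * D := by positivity
  have hn : D / 4 ≤ ⌊D / 2⌋₊ := by linarith [Nat.lt_floor_add_one (D / 2)]
  have hn2 : 2 ≤ ⌊D / 2⌋₊ := Nat.le_floor (by norm_num; linarith)
  have hcos : 1 - Real.cos (Real.pi / ⌊D / 2⌋₊) ≤ (Real.pi / (D / 4)) ^ 2 / 2 := by
    have hle : Real.pi / ⌊D / 2⌋₊ ≤ Real.pi / (D / 4) := by gcongr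
    have hsq : (Real.pi / ⌊D / 2⌋₊) ^ 2 ≤ (Real.pi / (D / 4)) ^ 2 := by gcongr
    linarith [Real.one_sub_sq_div_two_le_cos (x := Real.pi / ⌊D / 2⌋₊)]
  have hε : r / √(r * D) ≤ r := div_le_self hr.le <| Real.one_le_sqrt.2 <| by
    nlinarith [Real.pi_gt_three]
  have hη : (1 - Real.cos (Real.pi / ⌊D / 2⌋₊)) / (4 * (r / √(r * D)) ^ 2) ≤
      2 * Real.pi ^ 2 / (r * D) := by
    refine (div_le_div_of_nonneg_right hcos (by positivity)).trans_eq ?_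
    rw [div_pow, div_pow, div_pow, Real.sq_sqrt hq.le]
    field_simp
    norm_num
  have hη1 : 2 * Real.pi ^ 2 / (r * D) ≤ 1 / 2 := by
    rw [div_le_iff₀ hq]
    linarith
  convert exists_isDiscPair hn2 (div_pos hr (Real.sqrt_pos.2 hq)) hε hη hη1 using 3
  field_simp
  ring

theorem IsDiscPair.eq_zero_of_le {d : ℕ} {r C e D : ℝ} {a : TrigPoly × TrigPoly}
    (ha : IsDiscPair d r C e a) (hd : 2 * (d : ℝ) ≤ D) (hD : 0 < D) {n : ℤ × ℤ}
    (hn : D ≤ √((n.1 : ℝ) ^ 2 + (n.2 : ℝ) ^ 2)) : a.1 n = 0 ∧ a.2 n = 0 := by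
  have hbox : n ∉ box d := fun hmem => by
    have hsq {m : ℤ} (hm : |m| ≤ d) : (m : ℝ) ^ 2 ≤ (d : ℝ) ^ 2 :=
      sq_le_sq.2 <| by simpa using (Int.cast_le (R := ℝ)).2 hm
    obtain ⟨hfst, hsnd⟩ := mem_box.1 hmem
    rw [← not_lt, Real.sqrt_lt' hD] at hn
    nlinarith [hsq hfst, hsq hsnd]
  exact ⟨Finsupp.notMem_support_iff.1 fun h => hbox (ha.approximates_fst.support_subset h),
    Finsupp.notMem_support_iff.1 fun h => hbox (ha.approximates_snd.support_subset h)⟩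

theorem isMajorantMinorant_of_isDiscPair {r D δ : ℕ → ℝ} {d : ℕ → ℕ} {c : ℝ}
    {a : ℕ → TrigPoly × TrigPoly} (hD : ∀ᶠ N in atTop, 0 < D N ∧ 2 * (d N : ℝ) ≤ D N)
    (hδ : Tendsto δ atTop (𝓝 0))
    (ha : ∀ᶠ N in atTop, IsDiscPair (d N) (r N) (c * r N ^ 2) (δ N * r N ^ 2) (a N)) :
    IsMajorantMinorant r D (fun N => (a N).1) fun N => (a N).2 := by
  have hlittle {b : ℕ → TrigPoly}
      (hb : ∀ᶠ N in atTop, (b N).ApproximatesDisc (d N) (r N) (c * r N ^ 2) (δ N * r N ^ 2)) :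
      (fun N => b N 0 - (volume.real (disc 0 (r N)) : ℂ)) =o[atTop] fun N => r N ^ 2 := by
    refine IsLittleO.of_bound fun ε hε => ?_
    filter_upwards [hb, hδ.eventually_le_const hε] with N hN hδN
    rw [Real.norm_of_nonneg (sq_nonneg _)]
    exact hN.norm_apply_zero_sub_le.trans (by gcongr)
  exact
    { real := ha.mono fun N h x => ⟨h.approximates_fst.im_eval x, h.approximates_snd.im_eval x⟩
      majorant := ha.mono fun N h => h.majorant
      minorant := ha.mono fun N h => h.minorant
      degree := by
        filter_upwards [ha, hD] with N h hDN n hn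
        exact h.eq_zero_of_le hDN.2 hDN.1 hn
      coeff := ⟨c, ha.mono fun N h n =>
        ⟨h.approximates_fst.norm_apply_le n, h.approximates_snd.norm_apply_le n⟩⟩
      integral_plus := hlittle (ha.mono fun N h => h.approximates_fst)
      integral_minus := hlittle (ha.mono fun N h => h.approximates_snd) }

theorem exists_isMajorantMinorant {r D : ℕ → ℝ} (hr : ∀ᶠ N in atTop, 0 < r N)
    (hD : Tendsto D atTop atTop) (hrD : Tendsto (fun N => r N * D N) atTop atTop) :
    ∃ aPlus aMinus : ℕ → TrigPoly, IsMajorantMinorant r D aPlus aMinus := by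
  have hpair : ∀ᶠ N in atTop, ∃ a, IsDiscPair ⌊D N / 2⌋₊ (r N) (8 * Real.pi * r N ^ 2)
      (Real.pi * (3 / √(r N * D N) + 16 * Real.pi ^ 2 / (r N * D N)) * r N ^ 2) a := by
    filter_upwards [hr, hD.eventually_ge_atTop 4, hrD.eventually_ge_atTop (4 * Real.pi ^ 2)]
      with N hrN hDN hrDN
    exact exists_isDiscPair_floor hrN hDN hrDN
  obtain ⟨a, ha⟩ := hpair.choice
  have hδ : Tendsto (fun N => Real.pi * (3 / √(r N * D N) + 16 * Real.pi ^ 2 / (r N * D N)))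
      atTop (𝓝 0) := by
    simpa using (((Real.tendsto_sqrt_atTop.comp hrD).const_div_atTop 3).add
      (hrD.const_div_atTop (16 * Real.pi ^ 2))).const_mul Real.pi
  refine ⟨_, _, isMajorantMinorant_of_isDiscPair ?_ hδ ha⟩
  filter_upwards [hD.eventually_gt_atTop 0] with N hDN
  exact ⟨hDN, by linarith [Nat.floor_le (half_pos hDN).le]⟩

end ExistenceOfMajorants

section LogarithmicScale

variable {α : ℝ}

theorem tendsto_log_natCast : Tendsto (fun N : ℕ => Real.log N) atTop atTop :=
  Real.tendsto_log_atTop.comp tendsto_natCast_atTop_atTop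

theorem eventually_log_rpow_neg_mem_Ioc (hα : 0 ≤ α) :
    ∀ᶠ N : ℕ in atTop, Real.log N ^ (-α) ∈ Set.Ioc 0 1 := by
  filter_upwards [tendsto_log_natCast.eventually_ge_atTop 1] with N hN
  exact ⟨Real.rpow_pos_of_pos (by linarith) _,
    Real.rpow_le_one_of_one_le_of_nonpos hN (neg_nonpos.2 hα)⟩

theorem tendsto_atTop_of_mul_of_mem_Ioc {r D : ℕ → ℝ}
    (hr : ∀ᶠ N in atTop, r N ∈ Set.Ioc 0 1) (hrD : Tendsto (fun N => r N * D N) atTop atTop) :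
    Tendsto D atTop atTop := by
  refine tendsto_atTop_mono' atTop ?_ hrD
  filter_upwards [hr, hrD.eventually_gt_atTop 0] with N hrN hN
  exact mul_le_of_le_one_left ((pos_iff_pos_of_mul_pos hN).1 hrN.1).le hrN.2

end LogarithmicScale

end QuantumCat

end

theorem theorem1p3_general (M : SL(2, ℤ)) (hM : 2 < |(M : Matrix (Fin 2) (Fin 2) ℤ).trace|)
    {r D : ℕ → ℝ} (hr : ∀ᶠ N in atTop, 0 < r N) (hD : Tendsto D atTop atTop)
    (hrD : Tendsto (fun N => r N * D N) atTop atTop)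
    (hD4 : (fun N : ℕ => D N ^ 4) =o[atTop] fun N : ℕ => Real.log N) :
    (∃ aPlus aMinus : ℕ → QuantumCat.TrigPoly,
      QuantumCat.IsMajorantMinorant r D aPlus aMinus) ∧
    ∀ aPlus aMinus : ℕ → QuantumCat.TrigPoly,
      QuantumCat.IsMajorantMinorant r D aPlus aMinus →
      QuantumCat.QuantumErgodicityAtScale M r aPlus aMinus :=
  ⟨QuantumCat.exists_isMajorantMinorant hr hD hrD,
    fun _ _ ha => ha.quantumErgodicityAtScale hM (hD.eventually_ge_atTop 1) hD4⟩

theorem theorem1p3 (M : SL(2, ℤ)) (hM : 2 < |(M : Matrix (Fin 2) (Fin 2) ℤ).trace|)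
    (α : ℝ) (hα0 : 0 ≤ α) (hα1 : α < 1 / 4)
    (r : ℕ → ℝ) (hr : ∀ N : ℕ, r N = Real.log N ^ (-α))
    (D : ℕ → ℝ) (hD : Tendsto (fun N => r N * D N) atTop atTop)
    (hD' : (fun N : ℕ => D N ^ 4) =o[atTop] fun N : ℕ => Real.log N) :
    (∃ aPlus aMinus : ℕ → QuantumCat.TrigPoly,
      QuantumCat.IsMajorantMinorant r D aPlus aMinus) ∧
    ∀ aPlus aMinus : ℕ → QuantumCat.TrigPoly,
      QuantumCat.IsMajorantMinorant r D aPlus aMinus →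
      QuantumCat.QuantumErgodicityAtScale M r aPlus aMinus := by
  have hr_mem : ∀ᶠ N in atTop, r N ∈ Set.Ioc 0 1 := by
    simpa only [hr] using QuantumCat.eventually_log_rpow_neg_mem_Ioc hα0
  exact theorem1p3_general M hM (hr_mem.mono fun _ hN => hN.1)
    (QuantumCat.tendsto_atTop_of_mul_of_mem_Ioc hr_mem hD) hD hD'
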